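/- Let $\Bbbk$ be a field and let $\mathcal X$ be a finite regular cell complex on a topological space $X$ (a finite set of pairwise disjoint subsets of $X$, the cells, covering $X$ and including $\emptyset$, such that the closure of every nonempty cell $\sigma$ is homeomorphic to a closed ball of some dimension $i=:\dim\sigma$ with the open ball mapped onto $\sigma$, and such that the closure of every cell is a union of cells; $\dim\emptyset=-1$). Order the cells by $\tau\le\sigma$ iff $\tau\subset\overline\sigma$, and assume the intersection property: for all cells $\sigma,\tau$ there is a cell $\upsilon$ with $\overline\upsilon=\overline\sigma\cap\overline\tau$. Let a conical complex on $\mathcal X$ be given: for each cell $\sigma$ a finitely generated cone $C_\sigma\subset\mathbb R^{\dim\sigma+1}$ of dimension $\dim\sigma+1$, and for $\tau\le\sigma$ an injection $\iota_{\sigma,\tau}:C_\tau\to C_\sigma$ that extends to a linear map, whose image is a face of $C_\sigma$, such that every face of $C_\sigma$ is $\iota_{\sigma,\tau}(C_\tau)$ for a unique $\tau\le\sigma$, and such that $\iota_{\sigma,\sigma}=\mathrm{id}$ and $\iota_{\sigma,\tau}\circ\iota_{\tau,\upsilon}=\iota_{\sigma,\upsilon}$ for $\upsilon\le\tau\le\sigma$.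 Let $\mathcal M=\{M_\sigma\}$ be a monoidal complex supported by it: finitely generated submonoids $M_\sigma\subset\mathbb Z^{\dim\sigma+1}\cap C_\sigma$ with $\mathbb R_{\ge0}M_\sigma=C_\sigma$ such that $\iota_{\sigma,\tau}$ induces an isomorphism $M_\tau\cong M_\sigma\cap\iota_{\sigma,\tau}(C_\tau)$ for $\tau\le\sigma$. Assume that $\mathcal M$ is cone-wise normal: every semigroup ring $\Bbbk[M_\sigma]$ is normal. Put $|\mathcal M|=\varinjlim M_\sigma$ and $|\mathbb Z\mathcal M|=\varinjlim\mathbb ZM_\sigma$ (direct limits of sets). Let $R=\Bbbk[\mathcal M]$ be the toric face ring: the $\Bbbk$-algebra with basis $\{t^a\mid a\in|\mathcal M|\}$ and $t^at^b=t^{a+b}$ if $a,b\in M_\sigma$ for some $\sigma$, $t^at^b=0$ otherwise. For a cell $\sigma$ let $\mathfrak p_\sigma=(t^a\mid a\notin M_\sigma)\subset R$. For $a\in|\mathcal M|$ let $\operatorname{supp}(a)$ be the unique cell $\sigma$ such that $a$ lies in the relative interior of $C_\sigma$. A squarefree $R$-module is a finitely generated $R$-module $N$ with a decomposition $N=\bigoplus_{c\in|\mathbb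 Z\mathcal M|}N_c$ into $\Bbbk$-subspaces such that, for $a\in|\mathcal M|$ and $c\in|\mathbb Z\mathcal M|$, $t^aN_c\subset N_{a+c}$ if $a\in M_\sigma$ and $c\in\mathbb ZM_\sigma$ for some $\sigma$, and $t^aN_c=0$ otherwise; such that $N_c=0$ for $c\notin|\mathcal M|$; and such that multiplication by $t^b$ is a bijection $N_a\to N_{a+b}$ for all $a,b\in|\mathcal M|$ for which $a+b$ is defined and $\operatorname{supp}(a+b)=\operatorname{supp}(a)$. Let $\operatorname{Sq}R$ be the category of squarefree $R$-modules and degree-preserving $R$-linear maps; $R/\mathfrak p_\sigma$, with the grading induced by that of $R$, is an object of it. Let $\Lambda$ be the incidence algebra of the poset $\mathcal X$ over $\Bbbk$, with basis $\{e_{\sigma,\tau}\mid\sigma\ge\tau\}$ and $e_{\sigma,\tau}e_{\tau',\upsilon}=e_{\sigma,\upsilon}$ if $\tau=\tau'$, and $0$ otherwise. Then $\operatorname{Sq}R$ is equivalent to the category of finitely generated left $\Lambda$-modules. Moreover, $\operatorname{Sq}R$ (with pointwise addition of morphisms) is abelian and has enough injectives, and an object of $\operatorname{Sq}R$ is an indecomposable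 injective if and only if it is isomorphic to $R/\mathfrak p_\sigma$ for some cell $\sigma$. -/

import Mathlib

open CategoryTheory

universe u v

/-- A finite regular cell complex on the topological space `X`: a finite set of subsets of `X`
(the cells), containing `∅`. For a cell `σ`, `rank σ` is `dim σ + 1`, so that `rank ∅ = 0`. -/
structure RegularCellComplex (X : Type v) [TopologicalSpace X] where
  cells : Set (Set X)
  finite_cells : cells.Finite
  empty_mem : ∅ ∈ cells
  sUnion_cells : ⋃₀ cells = Set.univ
  disjoint_cells : ∀ σ ∈ cells, ∀ τ ∈ cells, σ ≠ τ → Disjoint σ τ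
  rank : {σ : Set X // σ ∈ cells} → ℕ
  rank_empty : rank ⟨∅, empty_mem⟩ = 0
  /-- The closure of a nonempty cell is homeomorphic to a closed ball, of dimension `dim σ`,
  the open ball being mapped onto the cell. -/
  exists_homeomorph : ∀ σ : {σ : Set X // σ ∈ cells}, σ.1 ≠ ∅ →
    ∃ i : ℕ, rank σ = i + 1 ∧
      ∃ φ : Metric.closedBall (0 : EuclideanSpace ℝ (Fin i)) 1 ≃ₜ closure σ.1,
        (fun x => (φ x : X)) ''
          {x | (x : EuclideanSpace ℝ (Fin i)) ∈ Metric.ball (0 : EuclideanSpace ℝ (Fin i)) 1} = σ.1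
  closure_eq_sUnion : ∀ σ ∈ cells, ∃ S ⊆ cells, closure σ = ⋃₀ S

namespace RegularCellComplex

variable {X : Type v} [TopologicalSpace X]

/-- The type of cells. -/
def Cell (K : RegularCellComplex X) : Type v := {σ : Set X // σ ∈ K.cells}

variable {K : RegularCellComplex X}

/-- The underlying subset of a cell. -/
def Cell.toSet (σ : K.Cell) : Set X := σ.1

/-- `dim σ + 1`. -/
def Cell.rank (σ : K.Cell) : ℕ := K.rank σ

/-- The empty cell. -/
def emptyCell (K : RegularCellComplex X) : K.Cell := ⟨∅, K.empty_mem⟩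

theorem Cell.eq_of_subset_closure {σ τ : K.Cell} (h₁ : σ.toSet ⊆ closure τ.toSet)
    (h₂ : τ.toSet ⊆ closure σ.toSet) : σ = τ := by
  by_contra hne
  have hne' : σ.1 ≠ τ.1 := fun h => hne (Subtype.ext h)
  have hdis := K.disjoint_cells σ.1 σ.2 τ.1 τ.2 hne'
  by_cases hσ : σ.1 = ∅
  · have : τ.1 ⊆ closure σ.1 := h₂
    rw [hσ, closure_empty, Set.subset_empty_iff] at this
    exact hne' (hσ.trans this.symm)
  · obtain ⟨i, -, φ, hφ⟩ := K.exists_homeomorph σ hσ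
    have hopen : IsOpen {x : Metric.closedBall (0 : EuclideanSpace ℝ (Fin i)) 1 |
        (x : EuclideanSpace ℝ (Fin i)) ∈ Metric.ball (0 : EuclideanSpace ℝ (Fin i)) 1} :=
      Metric.isOpen_ball.preimage continuous_subtype_val
    have hopen' := φ.isOpenMap _ hopen
    obtain ⟨U, hU, hUeq⟩ := isOpen_induced_iff.1 hopen'
    have key : ∀ q (hq : q ∈ closure σ.1), q ∈ U ↔ q ∈ σ.1 := by
      intro q hq
      have h := Set.ext_iff.1 hUeq ⟨q, hq⟩
      have h' := Set.ext_iff.1 hφ q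
      rw [← h']
      refine h.trans ⟨?_, ?_⟩
      · rintro ⟨x, hx, hxq⟩
        exact ⟨x, hx, congrArg Subtype.val hxq⟩
      · rintro ⟨x, hx, hxq⟩
        exact ⟨x, hx, Subtype.ext hxq⟩
    obtain ⟨p, hp⟩ := Set.nonempty_iff_ne_empty.2 hσ
    have hpU : p ∈ U := (key p (subset_closure hp)).2 hp
    obtain ⟨q, hqU, hqτ⟩ := mem_closure_iff.1 (h₁ hp) U hU hpU
    exact Set.disjoint_left.1 hdis ((key q (h₂ hqτ)).1 hqU) hqτ

/-- The cell poset: `τ ≤ σ` if `τ` is contained in the closure of `σ`. -/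
instance : PartialOrder K.Cell where
  le τ σ := τ.toSet ⊆ closure σ.toSet
  le_refl _ := subset_closure
  le_trans _ _ _ h₁ h₂ := h₁.trans (closure_minimal h₂ isClosed_closure)
  le_antisymm _ _ h₁ h₂ := Cell.eq_of_subset_closure h₁ h₂

theorem Cell.le_iff {σ τ : K.Cell} : τ ≤ σ ↔ τ.toSet ⊆ closure σ.toSet := Iff.rfl

theorem emptyCell_le (σ : K.Cell) : K.emptyCell ≤ σ := Set.empty_subset _

instance : Finite K.Cell := K.finite_cells

noncomputable instance : Fintype K.Cell := Fintype.ofFinite _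

noncomputable instance : DecidableEq K.Cell := Classical.decEq _

noncomputable instance : LocallyFiniteOrder K.Cell :=
  haveI : DecidableLE K.Cell := Classical.decRel _
  haveI : DecidableLT K.Cell := Classical.decRel _
  Fintype.toLocallyFiniteOrder

end RegularCellComplex

/-- A conical complex on the regular cell complex `K`, which must have the intersection property.
The face maps are given by their linear extensions, which are unique since the cones are
full-dimensional. -/
structure ConicalComplex {X : Type v} [TopologicalSpace X] (K : RegularCellComplex X) where
  inter : ∀ σ τ : K.Cell, ∃ υ : K.Cell,
    closure υ.toSet = closure σ.toSet ∩ closure τ.toSet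
  cone : ∀ σ : K.Cell, PointedCone ℝ (Fin σ.rank → ℝ)
  fg_cone : ∀ σ, (cone σ).FG
  /-- The cone `cone σ` has dimension `dim σ + 1`. -/
  span_cone : ∀ σ, Submodule.span ℝ (cone σ : Set (Fin σ.rank → ℝ)) = ⊤
  /-- The linear extension of the injection of `cone τ` into `cone σ`, for `τ ≤ σ`. -/
  ι : ∀ {τ σ : K.Cell}, τ ≤ σ → (Fin τ.rank → ℝ) →ₗ[ℝ] (Fin σ.rank → ℝ)
  injOn_ι : ∀ {τ σ : K.Cell} (h : τ ≤ σ), Set.InjOn (ι h) (cone τ)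
  isFaceOf : ∀ {τ σ : K.Cell} (h : τ ≤ σ), ((cone τ).map (ι h)).IsFaceOf (cone σ)
  existsUnique_face : ∀ (σ : K.Cell) (F : PointedCone ℝ (Fin σ.rank → ℝ)), F.IsFaceOf (cone σ) →
    ∃! τ : {τ : K.Cell // τ ≤ σ}, (cone τ.1).map (ι τ.2) = F
  ι_refl : ∀ (σ : K.Cell), ∀ x ∈ cone σ, ι (le_refl σ) x = x
  ι_comp : ∀ {υ τ σ : K.Cell} (h₁ : υ ≤ τ) (h₂ : τ ≤ σ), ∀ x ∈ cone υ,
    ι h₂ (ι h₁ x) = ι (h₁.trans h₂) x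

/-- A monoidal complex supported by a conical complex. -/
structure MonoidalComplex {X : Type v} [TopologicalSpace X] {K : RegularCellComplex X}
    (C : ConicalComplex K) where
  monoid : ∀ σ : K.Cell, AddSubmonoid (Fin σ.rank → ℝ)
  integral : ∀ σ, ∀ x ∈ monoid σ, ∀ i, ∃ z : ℤ, x i = z
  fg_monoid : ∀ σ, (monoid σ).FG
  /-- The cone generated by `monoid σ` is `cone σ`; in particular `monoid σ` lies in `cone σ`. -/
  hull_monoid : ∀ σ, PointedCone.hull ℝ (monoid σ : Set (Fin σ.rank → ℝ)) = C.cone σ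
  /-- The face map induces an isomorphism of `monoid τ` with the part of `monoid σ` that lies in
  the face corresponding to `τ`. -/
  image_monoid : ∀ {τ σ : K.Cell} (h : τ ≤ σ),
    C.ι h '' (monoid τ : Set (Fin τ.rank → ℝ)) =
      (monoid σ : Set (Fin σ.rank → ℝ)) ∩ C.ι h '' (C.cone τ : Set (Fin τ.rank → ℝ))

namespace MonoidalComplex

variable {X : Type v} [TopologicalSpace X] {K : RegularCellComplex X} {C : ConicalComplex K}

/-- The subgroup `ℤM_σ` generated by `M_σ`. -/
def group (M : MonoidalComplex C) (σ : K.Cell) : AddSubgroup (Fin σ.rank → ℝ) :=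
  AddSubgroup.closure (M.monoid σ)

/-- The set `|M|`, the direct limit of the `M_σ` along the face maps. -/
def Elem (M : MonoidalComplex C) : Type v :=
  Quot fun p q : (σ : K.Cell) × M.monoid σ =>
    ∃ h : p.1 ≤ q.1, C.ι h (p.2 : Fin p.1.rank → ℝ) = q.2

/-- The set `|ℤM|`, the direct limit of the `ℤM_σ` along the face maps. -/
def Deg (M : MonoidalComplex C) : Type v :=
  Quot fun p q : (σ : K.Cell) × M.group σ =>
    ∃ h : p.1 ≤ q.1, C.ι h (p.2 : Fin p.1.rank → ℝ) = q.2

variable (M : MonoidalComplex C)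

/-- The canonical map `M_σ → |M|`. -/
def elem (σ : K.Cell) (x : M.monoid σ) : M.Elem := Quot.mk _ ⟨σ, x⟩

/-- The canonical map `ℤM_σ → |ℤM|`. -/
def degree (σ : K.Cell) (y : M.group σ) : M.Deg := Quot.mk _ ⟨σ, y⟩

/-- The inclusion `M_σ → ℤM_σ`. -/
def toGroup {σ : K.Cell} (x : M.monoid σ) : M.group σ :=
  ⟨x, AddSubgroup.subset_closure x.2⟩

/-- The canonical map `|M| → |ℤM|`. -/
def toDeg : M.Elem → M.Deg :=
  Quot.map (fun p => ⟨p.1, M.toGroup p.2⟩) fun _ _ h => h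

variable {M}

/-- `a ∈ M_σ`, for `a ∈ |M|`. -/
def MemCell (a : M.Elem) (σ : K.Cell) : Prop := ∃ x, M.elem σ x = a

/-- `b ∈ ℤM_σ`, for `b ∈ |ℤM|`. -/
def DegMemCell (b : M.Deg) (σ : K.Cell) : Prop := ∃ y, M.degree σ y = b

/-- `a + b = c` in `|M|`: the sum is defined if `a` and `b` lie in a common `M_σ`, and is then
computed there. -/
def IsSum (a b c : M.Elem) : Prop :=
  ∃ (σ : K.Cell) (x y : M.monoid σ), M.elem σ x = a ∧ M.elem σ y = b ∧ M.elem σ (x + y) = c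

/-- `a + b = c` in `|ℤM|`, computed in some `ℤM_σ` with `a ∈ M_σ` and `b ∈ ℤM_σ`. -/
def IsDegSum (a : M.Elem) (b c : M.Deg) : Prop :=
  ∃ (σ : K.Cell) (x : M.monoid σ) (y : M.group σ),
    M.elem σ x = a ∧ M.degree σ y = b ∧ M.degree σ (M.toGroup x + y) = c

/-- `supp a = σ`: the element `a` lies in the relative interior of the cone of `σ`. -/
def IsSupp (a : M.Elem) (σ : K.Cell) : Prop :=
  ∃ x : M.monoid σ, M.elem σ x = a ∧
    (x : Fin σ.rank → ℝ) ∈ intrinsicInterior ℝ (C.cone σ : Set (Fin σ.rank → ℝ))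

/-! ### Facts on `|M|` needed to see that the multiplication is well defined and associative -/

theorem mem_cone {σ : K.Cell} (x : M.monoid σ) : (x : Fin σ.rank → ℝ) ∈ C.cone σ := by
  rw [← M.hull_monoid σ]
  exact Submodule.subset_span x.2

theorem ι_mem {τ σ : K.Cell} (h : τ ≤ σ) (z : M.monoid τ) : C.ι h z ∈ M.monoid σ := by
  have : C.ι h z ∈ C.ι h '' (M.monoid τ : Set (Fin τ.rank → ℝ)) := ⟨z, z.2, rfl⟩
  rw [M.image_monoid h] at this
  exact this.1

theorem elem_ι {τ σ : K.Cell} (h : τ ≤ σ) (z : M.monoid τ) :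
    M.elem σ ⟨C.ι h z, ι_mem h z⟩ = M.elem τ z :=
  (Quot.sound ⟨h, rfl⟩).symm

/-- Elements of `M_σ` lying on a face come from the monoid of that face. -/
theorem exists_of_mem_face {τ σ : K.Cell} (h : τ ≤ σ) (x : M.monoid σ)
    (hx : (x : Fin σ.rank → ℝ) ∈ (C.cone τ).map (C.ι h)) :
    ∃ z : M.monoid τ, C.ι h z = x := by
  have : (x : Fin σ.rank → ℝ) ∈ C.ι h '' (M.monoid τ : Set (Fin τ.rank → ℝ)) := by
    rw [M.image_monoid h]
    obtain ⟨y, hy, hyx⟩ := hx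
    exact ⟨x.2, y, hy, hyx⟩
  obtain ⟨z, hz, hzx⟩ := this
  exact ⟨⟨z, hz⟩, hzx⟩

theorem le_of_map_le {υ ρ τ : K.Cell} (h₁ : υ ≤ τ) (h₂ : ρ ≤ τ)
    (h : (C.cone υ).map (C.ι h₁) ≤ (C.cone ρ).map (C.ι h₂)) : υ ≤ ρ := by
  have hF := C.isFaceOf h₁
  have hρ := (C.isFaceOf h₂).le
  have hmem : ∀ x ∈ C.cone ρ, C.ι h₂ x ∈ C.cone τ := fun x hx => hρ ⟨x, hx, rfl⟩
  have hG : (((C.cone υ).map (C.ι h₁)).comap (C.ι h₂) ⊓ C.cone ρ).IsFaceOf (C.cone ρ) := by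
    refine ⟨inf_le_right, ?_⟩
    intro x y a hx hy ha hxy
    refine ⟨?_, hx⟩
    have h1 : C.ι h₂ (a • x + y) ∈ (C.cone υ).map (C.ι h₁) := hxy.1
    rw [map_add, map_smul] at h1
    exact hF.mem_of_smul_add_mem (hmem x hx) (hmem y hy) ha h1
  obtain ⟨⟨υ', hυ'⟩, hυ'G, -⟩ := C.existsUnique_face ρ _ hG
  have heq : (C.cone υ').map (C.ι (hυ'.trans h₂)) = (C.cone υ).map (C.ι h₁) := by
    apply le_antisymm
    · rintro _ ⟨x, hx, rfl⟩
      have : C.ι hυ' x ∈ (C.cone υ').map (C.ι hυ') := ⟨x, hx, rfl⟩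
      rw [hυ'G] at this
      have h1 : C.ι h₂ (C.ι hυ' x) ∈ (C.cone υ).map (C.ι h₁) := this.1
      rw [C.ι_comp hυ' h₂ x hx] at h1
      exact h1
    · intro y hy
      obtain ⟨x, hx, hxy⟩ := h hy
      have hx' : x ∈ ((C.cone υ).map (C.ι h₁)).comap (C.ι h₂) ⊓ C.cone ρ := by
        refine ⟨?_, hx⟩
        change C.ι h₂ x ∈ (C.cone υ).map (C.ι h₁)
        change C.ι h₂ x = y at hxy
        rw [hxy]; exact hy
      rw [← hυ'G] at hx'
      obtain ⟨w, hw, hwx⟩ := hx'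
      change C.ι hυ' w = x at hwx
      change C.ι h₂ x = y at hxy
      refine ⟨w, hw, ?_⟩
      change C.ι (hυ'.trans h₂) w = y
      rw [← C.ι_comp hυ' h₂ w hw, hwx, hxy]
  have := (C.existsUnique_face τ _ hF).unique (y₁ := ⟨υ', hυ'.trans h₂⟩) (y₂ := ⟨υ, h₁⟩) heq rfl
  have h3 : υ' = υ := congrArg Subtype.val this
  exact h3 ▸ hυ'

theorem elem_eq_iff {σ τ : K.Cell} {x : M.monoid σ} {y : M.monoid τ} :
    M.elem σ x = M.elem τ y ↔
      ∃ (ρ : K.Cell) (h₁ : ρ ≤ σ) (h₂ : ρ ≤ τ) (z : M.monoid ρ), C.ι h₁ z = x ∧ C.ι h₂ z = y := by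
  constructor
  · intro h
    have h' := Quot.eqvGen_exact h
    suffices H : ∀ p q : (σ : K.Cell) × M.monoid σ, Relation.EqvGen
        (fun p q : (σ : K.Cell) × M.monoid σ =>
          ∃ h : p.1 ≤ q.1, C.ι h (p.2 : Fin p.1.rank → ℝ) = q.2) p q →
        ∃ (ρ : K.Cell) (h₁ : ρ ≤ p.1) (h₂ : ρ ≤ q.1) (z : M.monoid ρ),
          C.ι h₁ z = p.2 ∧ C.ι h₂ z = q.2 from H _ _ h'
    intro p q hpq
    induction hpq with
    | rel p q h =>
      obtain ⟨h, e⟩ := h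
      exact ⟨p.1, le_refl _, h, p.2, C.ι_refl _ _ (mem_cone _), e⟩
    | refl p => exact ⟨p.1, le_refl _, le_refl _, p.2, C.ι_refl _ _ (mem_cone _),
        C.ι_refl _ _ (mem_cone _)⟩
    | symm p q _ ih =>
      obtain ⟨ρ, h₁, h₂, z, e₁, e₂⟩ := ih
      exact ⟨ρ, h₂, h₁, z, e₂, e₁⟩
    | trans p q r _ _ ih₁ ih₂ =>
      obtain ⟨ρ, h₁, h₂, z, e₁, e₂⟩ := ih₁
      obtain ⟨ρ', h₁', h₂', z', e₁', e₂'⟩ := ih₂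
      have hF := (C.isFaceOf h₂).inf_left (C.isFaceOf h₁')
      obtain ⟨⟨υ, hυ⟩, hυF, -⟩ := C.existsUnique_face q.1 _ hF
      have hυρ : υ ≤ ρ := le_of_map_le hυ h₂ (hυF.le.trans inf_le_left)
      have hυρ' : υ ≤ ρ' := le_of_map_le hυ h₁' (hυF.le.trans inf_le_right)
      have hy : (q.2 : Fin q.1.rank → ℝ) ∈ (C.cone υ).map (C.ι hυ) := by
        rw [hυF]
        exact ⟨⟨z, mem_cone z, e₂⟩, ⟨z', mem_cone z', e₁'⟩⟩
      obtain ⟨w, hw⟩ := exists_of_mem_face hυ q.2 hy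
      have k₁ : C.ι hυρ w = z := by
        apply C.injOn_ι h₂ (mem_cone ⟨_, ι_mem hυρ w⟩) (mem_cone z)
        rw [C.ι_comp hυρ h₂ w (mem_cone w), e₂]; exact hw
      have k₂ : C.ι hυρ' w = z' := by
        apply C.injOn_ι h₁' (mem_cone ⟨_, ι_mem hυρ' w⟩) (mem_cone z')
        rw [C.ι_comp hυρ' h₁' w (mem_cone w), e₁']; exact hw
      refine ⟨υ, hυρ.trans h₁, hυρ'.trans h₂', w, ?_, ?_⟩
      · rw [← C.ι_comp hυρ h₁ w (mem_cone w), k₁, e₁]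
      · rw [← C.ι_comp hυρ' h₂' w (mem_cone w), k₂, e₂']
  · rintro ⟨ρ, h₁, h₂, z, e₁, e₂⟩
    have k₁ : M.elem ρ z = M.elem σ x := Quot.sound ⟨h₁, e₁⟩
    have k₂ : M.elem ρ z = M.elem τ y := Quot.sound ⟨h₂, e₂⟩
    exact k₁.symm.trans k₂

theorem elem_injective (σ : K.Cell) : Function.Injective (M.elem σ) := by
  intro x y h
  obtain ⟨ρ, h₁, h₂, z, e₁, e₂⟩ := elem_eq_iff.1 h
  exact Subtype.ext (e₁.symm.trans e₂)

theorem MemCell.mono {a : M.Elem} {τ σ : K.Cell} (h : τ ≤ σ) (ha : MemCell a τ) :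
    MemCell a σ := by
  obtain ⟨x, rfl⟩ := ha
  exact ⟨_, elem_ι h x⟩

theorem exists_memCell (a : M.Elem) : ∃ σ, MemCell a σ := by
  obtain ⟨⟨σ, x⟩, rfl⟩ := Quot.exists_rep a
  exact ⟨σ, x, rfl⟩

theorem isSum_unique {a b c c' : M.Elem} (h : IsSum a b c) (h' : IsSum a b c') : c = c' := by
  obtain ⟨σ, x, y, hx, hy, rfl⟩ := h
  obtain ⟨τ, x', y', hx', hy', rfl⟩ := h'
  obtain ⟨ρ, h₁, h₂, z, e₁, e₂⟩ := elem_eq_iff.1 (hx.trans hx'.symm)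
  obtain ⟨ρ', h₁', h₂', z', e₁', e₂'⟩ := elem_eq_iff.1 (hy.trans hy'.symm)
  obtain ⟨υ, hυ⟩ := C.inter σ τ
  have hυσ : υ ≤ σ := fun p hp => (hυ.le (subset_closure hp)).1
  have hυτ : υ ≤ τ := fun p hp => (hυ.le (subset_closure hp)).2
  have hρυ : ρ ≤ υ := fun p hp => hυ.ge ⟨h₁ hp, h₂ hp⟩
  have hρυ' : ρ' ≤ υ := fun p hp => hυ.ge ⟨h₁' hp, h₂' hp⟩
  refine elem_eq_iff.2 ⟨υ, hυσ, hυτ, ⟨_, ι_mem hρυ z⟩ + ⟨_, ι_mem hρυ' z'⟩, ?_, ?_⟩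
  · change C.ι hυσ (C.ι hρυ z + C.ι hρυ' z') = x + y
    rw [map_add, C.ι_comp _ _ _ (mem_cone z), C.ι_comp _ _ _ (mem_cone z'), e₁, e₁']
  · change C.ι hυτ (C.ι hρυ z + C.ι hρυ' z') = x' + y'
    rw [map_add, C.ι_comp _ _ _ (mem_cone z), C.ι_comp _ _ _ (mem_cone z'), e₂, e₂']

theorem IsSum.symm {a b c : M.Elem} (h : IsSum a b c) : IsSum b a c := by
  obtain ⟨σ, x, y, hx, hy, hc⟩ := h
  exact ⟨σ, y, x, hy, hx, by rw [add_comm, hc]⟩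

theorem IsSum.memCell_left {a b c : M.Elem} (h : IsSum a b c) {σ : K.Cell} (hc : MemCell c σ) :
    MemCell a σ := by
  obtain ⟨τ, x, y, rfl, rfl, rfl⟩ := h
  obtain ⟨w, hw⟩ := hc
  obtain ⟨ρ, h₁, h₂, z, e₁, e₂⟩ := elem_eq_iff.1 hw
  have hface : (x : Fin τ.rank → ℝ) ∈ (C.cone ρ).map (C.ι h₂) :=
    (C.isFaceOf h₂).mem_of_add_mem_left (mem_cone x) (mem_cone y) ⟨z, mem_cone z, e₂⟩
  obtain ⟨x', hx'⟩ := exists_of_mem_face h₂ x hface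
  have : MemCell (M.elem τ x) ρ := ⟨x', Quot.sound ⟨h₂, hx'⟩⟩
  exact this.mono h₁

theorem IsSum.assoc {a b c d e : M.Elem} (h : IsSum a b d) (h' : IsSum d c e) :
    ∃ f, IsSum b c f ∧ IsSum a f e := by
  obtain ⟨σ, w, z, hw, hz, he⟩ := h'
  obtain ⟨x, hx⟩ := h.memCell_left ⟨w, hw⟩
  obtain ⟨y, hy⟩ := h.symm.memCell_left ⟨w, hw⟩
  have hd : M.elem σ (x + y) = M.elem σ w :=
    (isSum_unique ⟨σ, x, y, hx, hy, rfl⟩ h).trans hw.symm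
  refine ⟨M.elem σ (y + z), ⟨σ, y, z, hy, hz, rfl⟩, σ, x, y + z, hx, rfl, ?_⟩
  rw [← add_assoc, elem_injective σ hd, he]

variable (M)

/-- The zero element of `|M|`. -/
def zeroElem : M.Elem := M.elem K.emptyCell 0

variable {M}

theorem elem_zero (σ : K.Cell) : M.elem σ 0 = M.zeroElem := by
  rw [zeroElem, ← elem_ι (K.emptyCell_le σ) 0]
  congr 1
  exact Subtype.ext (map_zero (C.ι (K.emptyCell_le σ))).symm

theorem isSum_zero (a : M.Elem) : IsSum M.zeroElem a a := by
  obtain ⟨σ, x, rfl⟩ := exists_memCell a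
  exact ⟨σ, 0, x, elem_zero σ, rfl, by rw [zero_add]⟩

end MonoidalComplex

section ToricFaceRing

variable {X : Type v} [TopologicalSpace X] {K : RegularCellComplex X} {C : ConicalComplex K}

/-- The toric face ring of `M` over `k`: the vector space with basis `t^a`, `a ∈ |M|`. -/
def ToricFaceRing (k : Type u) [Field k] (M : MonoidalComplex C) : Type (max u v) := M.Elem →₀ k

namespace ToricFaceRing

open MonoidalComplex

variable (k : Type u) [Field k] (M : MonoidalComplex C)

noncomputable instance : AddCommGroup (ToricFaceRing k M) :=
  inferInstanceAs (AddCommGroup (M.Elem →₀ k))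

noncomputable instance : Module k (ToricFaceRing k M) :=
  inferInstanceAs (Module k (M.Elem →₀ k))

variable {M}

/-- The monomial `t^a`. -/
noncomputable def t (a : M.Elem) : ToricFaceRing k M := Finsupp.single a (1 : k)

/-- The basis of monomials. -/
noncomputable def basis : Module.Basis M.Elem k (ToricFaceRing k M) :=
  Finsupp.basisSingleOne

theorem basis_apply (a : M.Elem) : basis k a = t k a := by
  exact congrFun (Finsupp.coe_basisSingleOne (R := k) (ι := M.Elem)) a

open Classical in
/-- The product of two monomials: `t^a t^b = t^(a+b)` if `a + b` is defined, and `0` otherwise. -/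
noncomputable def mulMonomial (a b : M.Elem) : ToricFaceRing k M :=
  if h : ∃ c, IsSum a b c then t k h.choose else 0

variable (M) in
/-- The bilinear extension of the product of monomials. -/
noncomputable def mulBilin :
    ToricFaceRing k M →ₗ[k] ToricFaceRing k M →ₗ[k] ToricFaceRing k M :=
  (basis k).constr k fun a => (basis k).constr k fun b => mulMonomial k a b

noncomputable instance : Mul (ToricFaceRing k M) := ⟨fun f g => mulBilin k M f g⟩

noncomputable instance : One (ToricFaceRing k M) := ⟨t k M.zeroElem⟩

theorem mul_def (f g : ToricFaceRing k M) : f * g = mulBilin k M f g := rfl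

theorem one_def : (1 : ToricFaceRing k M) = t k M.zeroElem := rfl

theorem t_mul_t_eq_mulMonomial (a b : M.Elem) : t k a * t k b = mulMonomial k a b := by
  rw [mul_def, mulBilin, ← basis_apply, ← basis_apply, Module.Basis.constr_basis,
    Module.Basis.constr_basis]

theorem t_mul_t {a b c : M.Elem} (h : IsSum a b c) : t k a * t k b = t k c := by
  have h' : ∃ c, IsSum a b c := ⟨c, h⟩
  rw [t_mul_t_eq_mulMonomial, mulMonomial, dif_pos h', isSum_unique h'.choose_spec h]

theorem t_mul_t_of_not {a b : M.Elem} (h : ¬ ∃ c, IsSum a b c) : t k a * t k b = 0 := by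
  rw [t_mul_t_eq_mulMonomial, mulMonomial, dif_neg h]

theorem mul_zero' (f : ToricFaceRing k M) : f * 0 = 0 := by rw [mul_def, map_zero]

theorem zero_mul' (f : ToricFaceRing k M) : 0 * f = 0 := by
  rw [mul_def, map_zero, LinearMap.zero_apply]

theorem t_mul_comm (a b : M.Elem) : t k a * t k b = t k b * t k a := by
  by_cases h : ∃ c, IsSum a b c
  · obtain ⟨c, h⟩ := h
    rw [t_mul_t k h, t_mul_t k h.symm]
  · rw [t_mul_t_of_not k h, t_mul_t_of_not]
    rintro ⟨c, h'⟩
    exact h ⟨c, h'.symm⟩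

theorem mul_comm' (f g : ToricFaceRing k M) : f * g = g * f := by
  have : mulBilin k M = (mulBilin k M).flip := by
    refine (basis k).ext fun a => (basis k).ext fun b => ?_
    rw [basis_apply, basis_apply]
    exact t_mul_comm k a b
  exact congrArg (fun B => B f g) this

theorem t_mul_assoc (a b c : M.Elem) : t k a * t k b * t k c = t k a * (t k b * t k c) := by
  by_cases h : ∃ d e, IsSum a b d ∧ IsSum d c e
  · obtain ⟨d, e, h₁, h₂⟩ := h
    obtain ⟨f, h₃, h₄⟩ := h₁.assoc h₂
    rw [t_mul_t k h₁, t_mul_t k h₂, t_mul_t k h₃, t_mul_t k h₄]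
  · have hL : t k a * t k b * t k c = 0 := by
      by_cases h₁ : ∃ d, IsSum a b d
      · obtain ⟨d, h₁⟩ := h₁
        rw [t_mul_t k h₁]
        exact t_mul_t_of_not k fun ⟨e, h₂⟩ => h ⟨d, e, h₁, h₂⟩
      · rw [t_mul_t_of_not k h₁, zero_mul']
    have hR : t k a * (t k b * t k c) = 0 := by
      by_cases h₁ : ∃ f, IsSum b c f
      · obtain ⟨f, h₁⟩ := h₁
        rw [t_mul_t k h₁]
        refine t_mul_t_of_not k ?_
        rintro ⟨e, h₂⟩
        obtain ⟨d, h₃, h₄⟩ := h₁.symm.assoc h₂.symm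
        exact h ⟨d, e, h₃.symm, h₄.symm⟩
      · rw [t_mul_t_of_not k h₁, mul_zero']
    rw [hL, hR]

theorem induction_t {P : ToricFaceRing k M → Prop} (h0 : P 0)
    (hadd : ∀ f g, P f → P g → P (f + g)) (ht : ∀ (r : k) a, P (r • t k a)) (f : ToricFaceRing k M) :
    P f := by
  refine Finsupp.induction_linear (motive := P) f h0 hadd fun a r => ?_
  have h := ht r a
  have e : r • t k a = (Finsupp.single a r : M.Elem →₀ k) := by
    change r • (Finsupp.single a 1 : M.Elem →₀ k) = Finsupp.single a r
    rw [Finsupp.smul_single, smul_eq_mul, mul_one]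
  exact e ▸ h

theorem add_mul' (f g h : ToricFaceRing k M) : (f + g) * h = f * h + g * h := by
  rw [mul_def, map_add, LinearMap.add_apply]; rfl

theorem mul_add' (f g h : ToricFaceRing k M) : f * (g + h) = f * g + f * h := by
  rw [mul_def, map_add]; rfl

theorem smul_mul' (r : k) (f g : ToricFaceRing k M) : r • f * g = r • (f * g) := by
  rw [mul_def, map_smul, LinearMap.smul_apply]; rfl

theorem mul_smul' (r : k) (f g : ToricFaceRing k M) : f * r • g = r • (f * g) := by
  rw [mul_def, map_smul]; rfl

theorem mul_assoc' (f g h : ToricFaceRing k M) : f * g * h = f * (g * h) := by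
  induction f using induction_t k with
  | h0 => simp only [zero_mul']
  | hadd f₁ f₂ h₁ h₂ => simp only [add_mul', h₁, h₂]
  | ht r a =>
    induction g using induction_t k with
    | h0 => simp only [zero_mul', mul_zero']
    | hadd f₁ f₂ h₁ h₂ => simp only [add_mul', mul_add', h₁, h₂]
    | ht s b =>
      induction h using induction_t k with
      | h0 => simp only [mul_zero']
      | hadd f₁ f₂ h₁ h₂ => simp only [mul_add', h₁, h₂]
      | ht u c => simp only [smul_mul', mul_smul', t_mul_assoc]

theorem one_mul' (f : ToricFaceRing k M) : 1 * f = f := by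
  induction f using induction_t k with
  | h0 => rw [mul_zero']
  | hadd f₁ f₂ h₁ h₂ => rw [mul_add', h₁, h₂]
  | ht r a => rw [mul_smul', one_def, t_mul_t k (isSum_zero a)]

noncomputable instance : CommRing (ToricFaceRing k M) :=
  { (inferInstance : AddCommGroup (ToricFaceRing k M)),
    (inferInstance : Mul (ToricFaceRing k M)),
    (inferInstance : One (ToricFaceRing k M)) with
    left_distrib := mul_add' k
    right_distrib := add_mul' k
    zero_mul := zero_mul' k
    mul_zero := mul_zero' k
    mul_assoc := mul_assoc' k
    one_mul := one_mul' k
    mul_one := fun f => (mul_comm' k f 1).trans (one_mul' k f)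
    mul_comm := mul_comm' k }

noncomputable instance : Algebra k (ToricFaceRing k M) :=
  Algebra.ofModule (smul_mul' k) (fun r f g => mul_smul' k r f g)

variable (M) in
/-- The monomial prime ideal `𝔭_σ`, generated by the `t^a` with `a ∉ M_σ`. -/
noncomputable def primeIdeal (σ : K.Cell) : Ideal (ToricFaceRing k M) :=
  Ideal.span {f | ∃ a : M.Elem, ¬ MemCell a σ ∧ f = t k a}

end ToricFaceRing

/-- All affine semigroup rings `k[M_σ]` are normal. -/
def MonoidalComplex.IsConewiseNormal (k : Type u) [Field k] (M : MonoidalComplex C) : Prop :=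
  ∀ σ : K.Cell, IsIntegrallyClosed (AddMonoidAlgebra k (M.monoid σ))

end ToricFaceRing

section Graded

open MonoidalComplex

variable {X : Type v} [TopologicalSpace X] {K : RegularCellComplex X} {C : ConicalComplex K}

open Classical in
/-- A `ℤM`-graded module over the toric face ring `R` of `M`. -/
structure ZGradedModule (k : Type u) [Field k] (M : MonoidalComplex C) where
  carrier : Type (max u v)
  [addCommGroup : AddCommGroup carrier]
  [moduleField : Module k carrier]
  [module : Module (ToricFaceRing k M) carrier]
  [isScalarTower : IsScalarTower k (ToricFaceRing k M) carrier]
  /-- The homogeneous components. -/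
  deg : M.Deg → Submodule k carrier
  isInternal : DirectSum.IsInternal deg
  smul_mem : ∀ (a : M.Elem) (b c : M.Deg), IsDegSum a b c →
    ∀ m ∈ deg b, ToricFaceRing.t k a • m ∈ deg c
  smul_eq_zero : ∀ (a : M.Elem) (b : M.Deg), (¬ ∃ σ, MemCell a σ ∧ DegMemCell b σ) →
    ∀ m ∈ deg b, ToricFaceRing.t k a • m = 0

namespace ZGradedModule

variable {k : Type u} [Field k] {M : MonoidalComplex C}

attribute [instance] addCommGroup moduleField module isScalarTower

/-- Degree-preserving `R`-linear maps. -/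
@[ext]
structure Hom (A B : ZGradedModule k M) where
  toLinearMap : A.carrier →ₗ[ToricFaceRing k M] B.carrier
  map_deg : ∀ (c : M.Deg), ∀ m ∈ A.deg c, toLinearMap m ∈ B.deg c

namespace Hom

variable {A B : ZGradedModule k M}

theorem toLinearMap_injective :
    Function.Injective (Hom.toLinearMap : Hom A B → _) := fun _ _ h => Hom.ext h

noncomputable instance : Zero (Hom A B) := ⟨⟨0, fun c _ _ => (B.deg c).zero_mem⟩⟩

noncomputable instance : Add (Hom A B) := ⟨fun f g => ⟨f.toLinearMap + g.toLinearMap,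
  fun c m h => (B.deg c).add_mem (f.map_deg c m h) (g.map_deg c m h)⟩⟩

noncomputable instance : Neg (Hom A B) := ⟨fun f => ⟨-f.toLinearMap,
  fun c m h => (B.deg c).neg_mem (f.map_deg c m h)⟩⟩

noncomputable instance : Sub (Hom A B) := ⟨fun f g => ⟨f.toLinearMap - g.toLinearMap,
  fun c m h => (B.deg c).sub_mem (f.map_deg c m h) (g.map_deg c m h)⟩⟩

noncomputable instance : SMul ℕ (Hom A B) := ⟨fun n f => ⟨n • f.toLinearMap,
  fun c m h => nsmul_mem (f.map_deg c m h) n⟩⟩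

noncomputable instance : SMul ℤ (Hom A B) := ⟨fun n f => ⟨n • f.toLinearMap,
  fun c m h => zsmul_mem (f.map_deg c m h) n⟩⟩

noncomputable instance : AddCommGroup (Hom A B) :=
  toLinearMap_injective.addCommGroup _ rfl (fun _ _ => rfl) (fun _ => rfl) (fun _ _ => rfl)
    (fun _ _ => rfl) (fun _ _ => rfl)

end Hom

noncomputable instance : Category (ZGradedModule k M) where
  Hom A B := Hom A B
  id A := ⟨LinearMap.id, fun _ _ h => h⟩
  comp f g := ⟨g.toLinearMap.comp f.toLinearMap, fun c m h => g.map_deg c _ (f.map_deg c m h)⟩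

noncomputable instance : Preadditive (ZGradedModule k M) where
  homGroup A B := inferInstanceAs (AddCommGroup (Hom A B))
  add_comp _ _ _ _ _ _ := Hom.ext (LinearMap.comp_add _ _ _)
  comp_add _ _ _ _ _ _ := Hom.ext (LinearMap.add_comp _ _ _)

/-- `M`-graded: the components in degrees outside `|M|` vanish. -/
def IsMGraded (A : ZGradedModule k M) : Prop :=
  ∀ c : M.Deg, c ∉ Set.range M.toDeg → A.deg c = ⊥

variable (k M) in
/-- Squarefree modules: finitely generated `M`-graded modules on which multiplication by `t^b` is a
bijection from the component of degree `a` to that of degree `a + b` whenever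
`supp (a + b) = supp a`. -/
def isSquarefree : ObjectProperty (ZGradedModule k M) := fun A =>
  Module.Finite (ToricFaceRing k M) A.carrier ∧ A.IsMGraded ∧
    ∀ (a b c : M.Elem) (σ : K.Cell), IsSum a b c → IsSupp a σ → IsSupp c σ →
      Set.BijOn (fun m : A.carrier => ToricFaceRing.t k b • m)
        (A.deg (M.toDeg a)) (A.deg (M.toDeg c))

end ZGradedModule

/-- The category `Sq R` of squarefree modules over the toric face ring `R` of `M`. -/
abbrev SquarefreeModuleCat (k : Type u) [Field k] (M : MonoidalComplex C) :=
  (ZGradedModule.isSquarefree k M).FullSubcategory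

/-- The additive structure of `Sq R`: morphisms are added pointwise. -/
noncomputable instance SquarefreeModuleCat.preadditive (k : Type u) [Field k]
    (M : MonoidalComplex C) : Preadditive (SquarefreeModuleCat k M) :=
  Preadditive.fullSubcategory _

end Graded

/-! ### The squarefree module `R/𝔭_σ` -/

namespace MonoidalComplex

variable {X : Type v} [TopologicalSpace X] {K : RegularCellComplex X} {C : ConicalComplex K}
  {M : MonoidalComplex C}

theorem group_le_span (σ : K.Cell) (y : M.group σ) :
    ∃ u ∈ C.cone σ, ∃ w ∈ C.cone σ, (y : Fin σ.rank → ℝ) + w = u := by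
  obtain ⟨y, hy⟩ := y
  change ∃ u ∈ C.cone σ, ∃ w ∈ C.cone σ, y + w = u
  unfold group at hy
  induction hy using AddSubgroup.closure_induction with
  | mem x hx => exact ⟨x, mem_cone ⟨x, hx⟩, 0, zero_mem _, add_zero x⟩
  | zero => exact ⟨0, zero_mem _, 0, zero_mem _, add_zero 0⟩
  | add x y _ _ hx hy =>
    obtain ⟨u, hu, w, hw, rfl⟩ := hx
    obtain ⟨u', hu', w', hw', rfl⟩ := hy
    exact ⟨_, add_mem hu hu', _, add_mem hw hw', by abel⟩
  | neg x _ hx =>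
    obtain ⟨u, hu, w, hw, rfl⟩ := hx
    exact ⟨w, hw, _, hu, by abel⟩

/-- If the degree of `a ∈ |M|` is represented by `y ∈ ℤM_σ`, then `y ∈ M_σ` represents `a`. -/
theorem mem_of_degree_eq {a : M.Elem} {σ : K.Cell} {y : M.group σ} (h : M.degree σ y = M.toDeg a) :
    ∃ x : M.monoid σ, (x : Fin σ.rank → ℝ) = y ∧ M.elem σ x = a := by
  obtain ⟨⟨τ, x₀⟩, rfl⟩ := Quot.exists_rep a
  have h' := Quot.eqvGen_exact h
  suffices H : ∀ p q : (σ : K.Cell) × M.group σ, Relation.EqvGen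
      (fun p q : (σ : K.Cell) × M.group σ =>
        ∃ h : p.1 ≤ q.1, C.ι h (p.2 : Fin p.1.rank → ℝ) = q.2) p q →
      ∀ a : M.Elem,
      ((∃ x : M.monoid p.1, (x : Fin p.1.rank → ℝ) = p.2 ∧ M.elem p.1 x = a) ↔
      (∃ x : M.monoid q.1, (x : Fin q.1.rank → ℝ) = q.2 ∧ M.elem q.1 x = a)) from
    (H _ _ h' _).2 ⟨x₀, rfl, rfl⟩
  intro p q hpq
  induction hpq with
  | rel p q h =>
    intro a
    obtain ⟨h, e⟩ := h
    constructor
    · rintro ⟨x, hx, rfl⟩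
      exact ⟨⟨_, ι_mem h x⟩, by rw [← e, ← hx], elem_ι h x⟩
    · rintro ⟨x, hx, rfl⟩
      obtain ⟨u, hu, w, hw, hyu⟩ := group_le_span p.1 p.2
      have hx' : (x : Fin q.1.rank → ℝ) = C.ι h p.2 := hx.trans e.symm
      have hface : (x : Fin q.1.rank → ℝ) ∈ (C.cone p.1).map (C.ι h) := by
        refine (C.isFaceOf h).mem_of_add_mem_left (y := C.ι h w) (mem_cone x)
          ((C.isFaceOf h).le ⟨w, hw, rfl⟩) ⟨u, hu, ?_⟩
        change C.ι h u = x + C.ι h w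
        rw [hx', ← map_add, hyu]
      obtain ⟨z, hz⟩ := exists_of_mem_face h x hface
      refine ⟨z, ?_, Quot.sound ⟨h, hz⟩⟩
      have h1 : C.ι h (z + w) = C.ι h u := by
        rw [map_add, hz, hx', ← map_add, hyu]
      have h2 := C.injOn_ι h (add_mem (mem_cone z) hw) hu h1
      exact add_right_cancel (h2.trans hyu.symm)
  | refl p => exact fun _ => Iff.rfl
  | symm p q _ ih => exact fun a => (ih a).symm
  | trans p q r _ _ ih₁ ih₂ => exact fun a => (ih₁ a).trans (ih₂ a)

theorem toDeg_injective : Function.Injective M.toDeg := by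
  intro a b h
  obtain ⟨⟨σ, x⟩, rfl⟩ := Quot.exists_rep a
  obtain ⟨x', hx', h'⟩ := mem_of_degree_eq (σ := σ) (y := M.toGroup x) h
  have : x' = x := Subtype.ext hx'
  rw [← h', this]; rfl

theorem IsDegSum.exists_isSum {a b : M.Elem} {c : M.Deg} (h : IsDegSum a (M.toDeg b) c) :
    ∃ d, IsSum a b d ∧ M.toDeg d = c := by
  obtain ⟨σ, x, y, hx, hy, rfl⟩ := h
  obtain ⟨y', hy', hb⟩ := mem_of_degree_eq hy
  refine ⟨M.elem σ (x + y'), ⟨σ, x, y', hx, hb, rfl⟩, ?_⟩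
  change M.degree σ (M.toGroup (x + y')) = _
  congr 1
  apply Subtype.ext
  change (x : Fin σ.rank → ℝ) + y' = x + y
  rw [hy']

theorem IsSupp.le {a : M.Elem} {τ σ : K.Cell} (h : IsSupp a τ) (ha : MemCell a σ) : τ ≤ σ := by
  obtain ⟨x, rfl, hx⟩ := h
  obtain ⟨w, hw⟩ := ha
  obtain ⟨ρ, h₁, h₂, z, e₁, e₂⟩ := elem_eq_iff.1 hw
  have hxF : (x : Fin τ.rank → ℝ) ∈ (C.cone ρ).map (C.ι h₂) := ⟨z, mem_cone z, e₂⟩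
  have hle : C.cone τ ≤ (C.cone ρ).map (C.ι h₂) := by
    intro y hy
    obtain ⟨x', hx', hxx'⟩ := mem_intrinsicInterior.1 hx
    let A := affineSpan ℝ (C.cone τ : Set (Fin τ.rank → ℝ))
    have hyA : y ∈ A := subset_affineSpan ℝ _ hy
    have hxA : (x : Fin τ.rank → ℝ) ∈ A := subset_affineSpan ℝ _ (mem_cone x)
    let f : ℝ → A := fun ε => ⟨AffineMap.lineMap (x : Fin τ.rank → ℝ) y (-ε),
      AffineMap.lineMap_mem _ hxA hyA⟩
    have hf : Continuous f := by
      refine Continuous.subtype_mk ?_ _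
      exact AffineMap.lineMap_continuous.comp continuous_neg
    have hf0 : f 0 = x' := by
      apply Subtype.ext
      change AffineMap.lineMap (x : Fin τ.rank → ℝ) y (-(0 : ℝ)) = x'
      rw [neg_zero, AffineMap.lineMap_apply_zero, hxx']
    have hnhds : f ⁻¹' ((↑) ⁻¹' (C.cone τ : Set (Fin τ.rank → ℝ))) ∈ nhds (0 : ℝ) :=
      hf.continuousAt (hf0 ▸ mem_interior_iff_mem_nhds.1 hx')
    obtain ⟨ε, hε, hball⟩ := Metric.mem_nhds_iff.1 hnhds
    have hmem : ε / 2 ∈ Metric.ball (0 : ℝ) ε := by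
      rw [Metric.mem_ball, dist_zero_right, Real.norm_eq_abs, abs_of_pos (half_pos hε)]
      exact half_lt_self hε
    have hin : AffineMap.lineMap (x : Fin τ.rank → ℝ) y (-(ε / 2)) ∈ C.cone τ := hball hmem
    have hpos : 0 < ε / 2 := half_pos hε
    refine (C.isFaceOf h₂).mem_of_smul_add_mem (a := ε / 2) hy hin hpos ?_
    have : (ε / 2) • y + AffineMap.lineMap (x : Fin τ.rank → ℝ) y (-(ε / 2)) =
        (1 + ε / 2) • (x : Fin τ.rank → ℝ) := by
      rw [AffineMap.lineMap_apply_module]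
      module
    rw [this]
    exact Submodule.smul_mem _ (⟨1 + ε / 2, by positivity⟩ : {c : ℝ // 0 ≤ c}) hxF
  refine (le_of_map_le (C := C) (le_refl τ) h₂ ?_).trans h₁
  exact (C.isFaceOf (le_refl τ)).le.trans hle

end MonoidalComplex

namespace ToricFaceRing

open MonoidalComplex

variable {X : Type v} [TopologicalSpace X] {K : RegularCellComplex X} {C : ConicalComplex K}
  (k : Type u) [Field k] {M : MonoidalComplex C}

open Classical in
/-- The linear map that keeps the monomials in `M_σ` and kills the others. -/
noncomputable def restrictLin (σ : K.Cell) : ToricFaceRing k M →ₗ[k] ToricFaceRing k M :=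
  (basis k).constr k fun a => if MemCell a σ then t k a else 0

theorem restrictLin_t {σ : K.Cell} {a : M.Elem} (h : MemCell a σ) :
    restrictLin k σ (t k a) = t k a := by
  rw [← basis_apply, restrictLin, Module.Basis.constr_basis, if_pos h, basis_apply]

theorem restrictLin_t_of_not {σ : K.Cell} {a : M.Elem} (h : ¬ MemCell a σ) :
    restrictLin k σ (t k a) = 0 := by
  rw [← basis_apply, restrictLin, Module.Basis.constr_basis, if_neg h]

theorem restrictLin_t_mul (σ : K.Cell) (a b : M.Elem) :
    restrictLin k σ (t k a * t k b) = restrictLin k σ (t k a) * restrictLin k σ (t k b) := by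
  by_cases ha : MemCell a σ
  · by_cases hb : MemCell b σ
    · obtain ⟨x, hx⟩ := ha
      obtain ⟨y, hy⟩ := hb
      have h : IsSum a b (M.elem σ (x + y)) := ⟨σ, x, y, hx, hy, rfl⟩
      rw [restrictLin_t k ⟨x, hx⟩, restrictLin_t k ⟨y, hy⟩, t_mul_t k h, restrictLin_t k ⟨_, rfl⟩]
    · rw [restrictLin_t_of_not k hb, mul_zero]
      by_cases h : ∃ c, IsSum a b c
      · obtain ⟨c, h⟩ := h
        rw [t_mul_t k h, restrictLin_t_of_not k fun hc => hb (h.symm.memCell_left hc)]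
      · rw [t_mul_t_of_not k h, map_zero]
  · rw [restrictLin_t_of_not k ha, zero_mul]
    by_cases h : ∃ c, IsSum a b c
    · obtain ⟨c, h⟩ := h
      rw [t_mul_t k h, restrictLin_t_of_not k fun hc => ha (h.memCell_left hc)]
    · rw [t_mul_t_of_not k h, map_zero]

theorem restrictLin_mul (σ : K.Cell) (f g : ToricFaceRing k M) :
    restrictLin k σ (f * g) = restrictLin k σ f * restrictLin k σ g := by
  induction f using induction_t k with
  | h0 => simp only [zero_mul, map_zero]
  | hadd f₁ f₂ h₁ h₂ => simp only [add_mul, map_add, h₁, h₂]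
  | ht r a =>
    induction g using induction_t k with
    | h0 => simp only [mul_zero, map_zero]
    | hadd f₁ f₂ h₁ h₂ => simp only [mul_add, map_add, h₁, h₂]
    | ht s b => simp only [smul_mul_assoc, mul_smul_comm, map_smul, restrictLin_t_mul]

theorem restrictLin_one (σ : K.Cell) : restrictLin k σ (1 : ToricFaceRing k M) = 1 :=
  restrictLin_t k ⟨0, elem_zero σ⟩

/-- The same map as an algebra homomorphism; its kernel is `𝔭_σ`. -/
noncomputable def restrict (σ : K.Cell) : ToricFaceRing k M →ₐ[k] ToricFaceRing k M :=
  AlgHom.ofLinearMap (restrictLin k σ) (restrictLin_one k σ) (restrictLin_mul k σ)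

theorem restrict_eq_zero {σ : K.Cell} (f : ToricFaceRing k M) (hf : f ∈ primeIdeal k M σ) :
    restrict k σ f = 0 := by
  unfold primeIdeal Ideal.span at hf
  induction hf using Submodule.span_induction with
  | mem x h =>
    obtain ⟨a, ha, rfl⟩ := h
    exact restrictLin_t_of_not k ha
  | zero => exact map_zero _
  | add x y _ _ hx hy => rw [map_add, hx, hy, add_zero]
  | smul r x _ hx => rw [smul_eq_mul, map_mul, hx, mul_zero]

/-- The map induced on `R/𝔭_σ`. -/
noncomputable def restrictQuot (σ : K.Cell) :
    (ToricFaceRing k M ⧸ primeIdeal k M σ) →ₐ[k] ToricFaceRing k M :=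
  Ideal.Quotient.liftₐ _ (restrict k σ) (restrict_eq_zero k)

/-- The class of `t^a` in `R/𝔭_σ`. -/
noncomputable def tQuot (σ : K.Cell) (a : M.Elem) : ToricFaceRing k M ⧸ primeIdeal k M σ :=
  Ideal.Quotient.mk _ (t k a)

theorem tQuot_of_not {σ : K.Cell} {a : M.Elem} (h : ¬ MemCell a σ) : tQuot k σ a = 0 :=
  Ideal.Quotient.eq_zero_iff_mem.2 (Ideal.subset_span ⟨a, h, rfl⟩)

theorem restrictQuot_tQuot {σ : K.Cell} {a : M.Elem} (h : MemCell a σ) :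
    restrictQuot k σ (tQuot k σ a) = t k a :=
  restrictLin_t k h

theorem t_smul_tQuot {σ : K.Cell} {a b c : M.Elem} (h : IsSum a b c) :
    t k a • tQuot k σ b = tQuot k σ c := by
  change Ideal.Quotient.mk _ (t k a * t k b) = _
  rw [t_mul_t k h]; rfl

theorem t_smul_tQuot_of_not {σ : K.Cell} {a b : M.Elem} (h : ¬ ∃ c, IsSum a b c) :
    t k a • tQuot k σ b = 0 := by
  change Ideal.Quotient.mk _ (t k a * t k b) = _
  rw [t_mul_t_of_not k h, map_zero]

theorem span_tQuot (σ : K.Cell) :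
    Submodule.span k (Set.range (tQuot k σ (M := M))) = ⊤ := by
  rw [eq_top_iff]
  rintro x -
  obtain ⟨f, rfl⟩ := Ideal.Quotient.mk_surjective x
  induction f using induction_t k with
  | h0 => rw [map_zero]; exact zero_mem _
  | hadd f₁ f₂ h₁ h₂ => rw [map_add]; exact add_mem h₁ h₂
  | ht r a =>
    have ha : tQuot k σ a ∈ Submodule.span k (Set.range (tQuot k σ (M := M))) :=
      Submodule.subset_span ⟨a, rfl⟩
    exact Submodule.smul_mem _ r ha

theorem restrictQuot_injective (σ : K.Cell) :
    Function.Injective (restrictQuot k σ (M := M)) := by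
  have h : ∀ x, Ideal.Quotient.mk (primeIdeal k M σ) (restrictQuot k σ x) = x := by
    intro x
    have hx : x ∈ Submodule.span k (Set.range (tQuot k σ (M := M))) := by
      rw [span_tQuot]; trivial
    induction hx using Submodule.span_induction with
    | mem x h =>
      obtain ⟨a, rfl⟩ := h
      by_cases ha : MemCell a σ
      · rw [restrictQuot_tQuot k ha]; rfl
      · rw [tQuot_of_not k ha, map_zero, map_zero]
    | zero => rw [map_zero, map_zero]
    | add x y _ _ hx hy => rw [map_add, map_add, hx, hy]
    | smul r x _ hx =>
      rw [map_smul]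
      exact congrArg (r • ·) hx
  exact Function.LeftInverse.injective h

/-- The component of degree `c` of `R/𝔭_σ`, spanned by the classes of the monomials of degree
`c`. -/
noncomputable def quotDeg (σ : K.Cell) (c : M.Deg) : Submodule k (ToricFaceRing k M ⧸ primeIdeal k M σ) :=
  Submodule.span k {m | ∃ a : M.Elem, M.toDeg a = c ∧ m = tQuot k σ a}

theorem tQuot_mem_quotDeg (σ : K.Cell) (a : M.Elem) : tQuot k σ a ∈ quotDeg k σ (M.toDeg a) :=
  Submodule.subset_span ⟨a, rfl, rfl⟩

theorem quotDeg_toDeg (σ : K.Cell) (a : M.Elem) :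
    quotDeg k σ (M.toDeg a) = Submodule.span k {tQuot k σ a} := by
  unfold quotDeg
  congr 1
  ext m
  constructor
  · rintro ⟨b, hb, rfl⟩
    rw [toDeg_injective hb]; rfl
  · rintro rfl
    exact ⟨a, rfl, rfl⟩

theorem coord_restrictQuot {σ : K.Cell} {c : M.Deg} {a : M.Elem} (ha : M.toDeg a ≠ c)
    {x : ToricFaceRing k M ⧸ primeIdeal k M σ} (hx : x ∈ quotDeg k σ c) :
    (basis k).coord a (restrictQuot k σ x) = 0 := by
  unfold quotDeg at hx
  induction hx using Submodule.span_induction with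
  | mem x h =>
    obtain ⟨b, hb, rfl⟩ := h
    by_cases hbσ : MemCell b σ
    · rw [restrictQuot_tQuot k hbσ, ← basis_apply, Module.Basis.coord_apply,
        Module.Basis.repr_self, Finsupp.single_eq_of_ne]
      rintro rfl
      exact ha hb
    · rw [tQuot_of_not k hbσ, map_zero, map_zero]
  | zero => rw [map_zero, map_zero]
  | add x y _ _ hx hy => rw [map_add, map_add, hx, hy, add_zero]
  | smul r x _ hx => rw [map_smul, map_smul, hx, smul_zero]

open Classical in
theorem quotDeg_isInternal (σ : K.Cell) : DirectSum.IsInternal (quotDeg k σ (M := M)) := by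
  apply DirectSum.isInternal_submodule_of_iSupIndep_of_iSup_eq_top
  · rw [iSupIndep_def]
    intro c
    rw [Submodule.disjoint_def]
    intro x hx hx'
    apply restrictQuot_injective k σ
    rw [map_zero]
    refine (basis k).ext_elem fun a => ?_
    rw [map_zero, Finsupp.zero_apply, ← Module.Basis.coord_apply]
    by_cases ha : M.toDeg a = c
    · have hle : (⨆ j, ⨆ (_ : j ≠ c), quotDeg k σ j) ≤
          LinearMap.ker (((basis k).coord a).comp (restrictQuot k σ).toLinearMap) := by
        refine iSup_le fun j => iSup_le fun hj y hy => ?_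
        exact coord_restrictQuot k (fun h => hj (h.symm.trans ha)) hy
      exact hle hx'
    · exact coord_restrictQuot k ha hx
  · rw [eq_top_iff, ← span_tQuot k σ, Submodule.span_le]
    rintro _ ⟨a, rfl⟩
    exact Submodule.mem_iSup_of_mem _ (tQuot_mem_quotDeg k σ a)

variable (M) in
/-- `R/𝔭_σ` as a `ℤM`-graded module, with the grading induced by that of `R`. -/
noncomputable def quotGraded (σ : K.Cell) : ZGradedModule k M where
  carrier := ToricFaceRing k M ⧸ primeIdeal k M σ
  deg := quotDeg k σ
  isInternal := quotDeg_isInternal k σ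
  smul_mem a b c h m hm := by
    unfold quotDeg at hm
    induction hm using Submodule.span_induction with
    | mem x hx =>
      obtain ⟨b', rfl, rfl⟩ := hx
      obtain ⟨d, hd, rfl⟩ := h.exists_isSum
      rw [t_smul_tQuot k hd]
      exact tQuot_mem_quotDeg k σ d
    | zero => rw [smul_zero]; exact zero_mem _
    | add x y _ _ hx hy => rw [smul_add]; exact add_mem hx hy
    | smul r x _ hx => rw [smul_comm]; exact Submodule.smul_mem _ r hx
  smul_eq_zero a b h m hm := by
    unfold quotDeg at hm
    induction hm using Submodule.span_induction with
    | mem x hx =>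
      obtain ⟨b', rfl, rfl⟩ := hx
      refine t_smul_tQuot_of_not k ?_
      rintro ⟨c, τ, x, y, hx, rfl, -⟩
      have hy : DegMemCell (M.toDeg (M.elem τ y)) τ := ⟨M.toGroup y, rfl⟩
      exact h ⟨τ, ⟨x, hx⟩, hy⟩
    | zero => rw [smul_zero]
    | add x y _ _ hx hy => rw [smul_add, hx, hy, add_zero]
    | smul r x _ hx => rw [smul_comm, hx, smul_zero]

theorem isSquarefree_quotGraded (σ : K.Cell) :
    ZGradedModule.isSquarefree k M (quotGraded k M σ) := by
  refine ⟨?_, ?_, ?_⟩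
  · change Module.Finite (ToricFaceRing k M) (ToricFaceRing k M ⧸ primeIdeal k M σ)
    infer_instance
  · intro c hc
    change quotDeg k σ c = ⊥
    unfold quotDeg
    rw [Submodule.span_eq_bot]
    rintro _ ⟨a, rfl, -⟩
    exact absurd ⟨a, rfl⟩ hc
  · intro a b c τ habc ha hc
    change Set.BijOn (fun m : ToricFaceRing k M ⧸ primeIdeal k M σ => t k b • m)
      (quotDeg k σ (M.toDeg a)) (quotDeg k σ (M.toDeg c))
    have hsmul : ∀ r : k, t k b • r • tQuot k σ a = r • tQuot k σ c := by
      intro r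
      rw [smul_comm, t_smul_tQuot k habc.symm]
    rw [quotDeg_toDeg, quotDeg_toDeg]
    refine ⟨?_, ?_, ?_⟩
    · intro m hm
      obtain ⟨r, rfl⟩ := Submodule.mem_span_singleton.1 hm
      exact Submodule.mem_span_singleton.2 ⟨r, (hsmul r).symm⟩
    · intro m hm m' hm' h
      obtain ⟨r, rfl⟩ := Submodule.mem_span_singleton.1 hm
      obtain ⟨s, rfl⟩ := Submodule.mem_span_singleton.1 hm'
      by_cases haσ : MemCell a σ
      · have hcσ : MemCell c σ := by
          obtain ⟨z, hz, -⟩ := hc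
          exact MemCell.mono (ha.le haσ) ⟨z, hz⟩
        have h' : r • tQuot k σ c = s • tQuot k σ c := by
          rw [← hsmul, ← hsmul]; exact h
        have h'' := congrArg (fun m => (basis k).coord c (restrictQuot k σ m)) h'
        simp only [map_smul, restrictQuot_tQuot k hcσ] at h''
        rw [← basis_apply, Module.Basis.coord_apply, Module.Basis.repr_self,
          Finsupp.single_eq_same, smul_eq_mul, smul_eq_mul, mul_one, mul_one] at h''
        rw [h'']
      · rw [tQuot_of_not k haσ, smul_zero, smul_zero]
    · intro m hm
      obtain ⟨r, rfl⟩ := Submodule.mem_span_singleton.1 hm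
      exact ⟨r • tQuot k σ a, Submodule.mem_span_singleton.2 ⟨r, rfl⟩, hsmul r⟩

end ToricFaceRing

/-- `R/𝔭_σ` as an object of `Sq R`. -/
noncomputable def quotPrime {X : Type v} [TopologicalSpace X] {K : RegularCellComplex X}
    {C : ConicalComplex K} (k : Type u) [Field k] (M : MonoidalComplex C) (σ : K.Cell) :
    SquarefreeModuleCat k M :=
  ⟨ToricFaceRing.quotGraded k M σ, ToricFaceRing.isSquarefree_quotGraded k σ⟩

/-- The incidence algebra `Λ` of the cell poset over `k`, with basis `e_{σ,τ}` for `σ ≥ τ` and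
multiplication `e_{σ,τ} e_{τ,υ} = e_{σ,υ}`. Mathlib's incidence algebra of a poset has its basis
indexed by the pairs `σ ≤ τ`, so the order is reversed. -/
abbrev CellIncidenceAlgebra {X : Type v} [TopologicalSpace X] (K : RegularCellComplex X)
    (k : Type u) [Field k] : Type (max u v) :=
  IncidenceAlgebra k K.Cellᵒᵈ

/-! A squarefree module is a representation of the cell poset. Squarefreeness makes the component of
degree `a` depend, up to canonical isomorphism, only on the cell `supp a`. If `supp a ≤ supp b`,
then `t^a` acts bijectively from degree `b` to degree `a + b`, so there is a canonical map "multiply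
by `t^b`, then divide by `t^a`" from degree `a` to degree `b`. This is `transport`. It is functorial
(`transport_transport`), natural (`appComp_transport`), and includes multiplication by monomials
(`transport_isSum`).

The combinatorial input concerns supports. Every element of `|M|` has one, by supporting hyperplanes
(`exists_isSupp`). The support of a sum is the join of the supports (`IsSum.supp_le_iff`). Every
cell occurs as a support (`exists_supp_eq`). Finitely many elements suffice up to summands that do
not change the support (`exists_finset_isSum`).

A left `Λ`-module `N` is the family of spaces `e_{σ,σ} N` with maps `e_{σ,τ} : e_{τ,τ} N → e_{σ,σ}
N` for `τ ≤ σ`. The functor `toSquarefree` puts `e_{σ,σ} N` in each degree with support `σ` and lets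
`t^b` act by the appropriate `e_{σ,τ}`. Under this dictionary `e_{σ,τ}` is transport
(`eval_transport`), which gives fullness. Conversely, choosing one degree for each cell recovers a
squarefree module from its stalks (`stalksIso`). The finiteness conditions correspond by
`finite_comp` and `isSquarefree_gradedSections`.

The module `R/𝔭_σ` is the representation with value `k` on the cells below `σ`, identity maps
between them, and zero elsewhere. Thus morphisms `N ⟶ R/𝔭_σ` are the linear functionals on the stalk
`N_σ` (`toQuotPrime`, `quotPrime_hom_ext`). Functionals extend along injections, so `R/𝔭_σ` is
injective; its endomorphisms are scalars, so it is indecomposable. Bases of the stalks embed any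
object into a finite sum of such modules. For an injective object this embedding splits, and a cell
maximal among those with nonzero stalk produces a summand `R/𝔭_σ`. -/

namespace MonoidalComplex

variable {X : Type v} [TopologicalSpace X] {K : RegularCellComplex X} {C : ConicalComplex K}
  {M : MonoidalComplex C}

/-! ### Supports of elements of `|M|` -/

theorem memCell_elem_iff {τ σ : K.Cell} (h : τ ≤ σ) (x : M.monoid σ) :
    MemCell (M.elem σ x) τ ↔ (x : Fin σ.rank → ℝ) ∈ (C.cone τ).map (C.ι h) := by
  constructor
  · rintro ⟨z, hz⟩
    rw [← elem_ι h z] at hz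
    rw [← elem_injective σ hz]
    exact ⟨z, mem_cone z, rfl⟩
  · intro hx
    obtain ⟨z, hz⟩ := exists_of_mem_face h x hx
    exact ⟨z, Quot.sound ⟨h, hz⟩⟩

/-- The cone contains `0`, so its affine span is its linear span, which is the whole space. -/
theorem interior_cone_nonempty (C : ConicalComplex K) (σ : K.Cell) :
    (interior (C.cone σ : Set (Fin σ.rank → ℝ))).Nonempty := by
  rw [(C.cone σ).convex.interior_nonempty_iff_affineSpan_eq_top]
  have h0 : insert (0 : Fin σ.rank → ℝ) (C.cone σ : Set (Fin σ.rank → ℝ)) = C.cone σ :=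
    Set.insert_eq_of_mem (zero_mem (C.cone σ))
  apply SetLike.coe_injective
  rw [← h0, affineSpan_insert_zero, C.span_cone]
  rfl

/-- A point of the cone outside its interior lies on a proper face. -/
theorem exists_proper_face (σ : K.Cell) {x : Fin σ.rank → ℝ} (hx : x ∈ C.cone σ)
    (hx' : x ∉ interior (C.cone σ : Set (Fin σ.rank → ℝ))) :
    ∃ F : PointedCone ℝ (Fin σ.rank → ℝ), F.IsFaceOf (C.cone σ) ∧ x ∈ F ∧ ¬ C.cone σ ≤ F := by
  -- A hyperplane through `x` that misses the interior; by density of the interior it supports the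
  -- cone.
  obtain ⟨f, hf⟩ := geometric_hahn_banach_open_point (C.cone σ).convex.interior isOpen_interior hx'
  have hle : ∀ y ∈ C.cone σ, f y ≤ f x := by
    intro y hy
    have hcl : y ∈ closure (interior (C.cone σ : Set (Fin σ.rank → ℝ))) := by
      rw [(C.cone σ).convex.closure_interior_eq_closure_of_nonempty_interior
        (interior_cone_nonempty C σ)]
      exact subset_closure hy
    have hclosed : IsClosed {y | f y ≤ f x} := isClosed_le f.continuous continuous_const
    exact closure_minimal (fun z hz => (hf z hz).le) hclosed hcl
  -- Comparing `f x` with `f 0` and `f (x + x)` forces the hyperplane through the origin. The face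
  -- sought is where `f` vanishes on the cone.
  have hfx : f x = 0 := by
    have h0 := hle 0 (zero_mem _)
    have h2 := hle (x + x) (add_mem hx hx)
    rw [map_zero] at h0
    rw [map_add] at h2
    linarith
  have hnp : ∀ y ∈ C.cone σ, f y ≤ 0 := fun y hy => hfx ▸ hle y hy
  refine ⟨{ carrier := {y | y ∈ C.cone σ ∧ f y = 0}
            add_mem' := ?_
            zero_mem' := ⟨zero_mem _, map_zero f⟩
            smul_mem' := ?_ }, ⟨fun y hy => hy.1, ?_⟩, ⟨hx, hfx⟩, ?_⟩
  · rintro a b ⟨ha, ha'⟩ ⟨hb, hb'⟩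
    exact ⟨add_mem ha hb, by rw [map_add, ha', hb', add_zero]⟩
  · rintro r a ⟨ha, ha'⟩
    refine ⟨Submodule.smul_mem _ r ha, ?_⟩
    change f ((r : ℝ) • a) = 0
    rw [map_smul, ha', smul_zero]
  · rintro a b r ha hb hr ⟨-, h⟩
    refine ⟨ha, ?_⟩
    rw [map_add, map_smul, smul_eq_mul] at h
    have h1 := hnp a ha
    have h2 := hnp b hb
    have h3 : r * f a = 0 := le_antisymm (mul_nonpos_of_nonneg_of_nonpos hr.le h1) (by linarith)
    exact (mul_eq_zero.1 h3).resolve_left hr.ne'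
  · intro hF
    obtain ⟨y, hy⟩ := interior_cone_nonempty C σ
    have h1 := hf y hy
    have h2 : f y = 0 := (hF (interior_subset hy)).2
    rw [h2, hfx] at h1
    exact lt_irrefl _ h1

/-- A minimal cell `σ` with `a ∈ M_σ` works: a representative outside the interior of the cone would
lie on a proper face, hence in the monoid of a smaller cell. -/
theorem exists_isSupp (a : M.Elem) : ∃ σ, IsSupp a σ := by
  obtain ⟨σ, hσ, hmin⟩ := (wellFounded_lt (α := K.Cell)).has_min {σ | MemCell a σ}
    (exists_memCell a)
  obtain ⟨x, rfl⟩ := hσ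
  refine ⟨σ, x, rfl, interior_subset_intrinsicInterior ?_⟩
  by_contra hx
  obtain ⟨F, hF, hxF, hne⟩ := exists_proper_face σ (mem_cone x) hx
  obtain ⟨⟨τ, hτ⟩, rfl, -⟩ := C.existsUnique_face σ F hF
  rcases hτ.lt_or_eq with hlt | rfl
  · exact hmin τ ((memCell_elem_iff hτ x).2 hxF) hlt
  · refine hne fun y hy => ⟨y, hy, ?_⟩
    exact C.ι_refl _ y hy

/-- The support of an element of `|M|`. -/
noncomputable def supp (a : M.Elem) : K.Cell := (exists_isSupp a).choose

theorem isSupp_supp (a : M.Elem) : IsSupp a (supp a) := (exists_isSupp a).choose_spec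

theorem IsSupp.memCell {a : M.Elem} {σ : K.Cell} (h : IsSupp a σ) : MemCell a σ := by
  obtain ⟨x, hx, -⟩ := h
  exact ⟨x, hx⟩

/-- Replaces membership in `M_σ` by an inequality of cells, so that later arguments take place in
the poset. -/
theorem memCell_iff {a : M.Elem} {σ : K.Cell} : MemCell a σ ↔ supp a ≤ σ :=
  ⟨(isSupp_supp a).le, fun h => (isSupp_supp a).memCell.mono h⟩

theorem IsSupp.supp_eq {a : M.Elem} {σ : K.Cell} (h : IsSupp a σ) : supp a = σ :=
  le_antisymm (memCell_iff.1 h.memCell) (h.le (isSupp_supp a).memCell)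

theorem supp_elem_le {σ : K.Cell} (x : M.monoid σ) : supp (M.elem σ x) ≤ σ :=
  memCell_iff.1 ⟨x, rfl⟩

/-- Summands of an element of a face lie in that face. Hence the support of a sum is the join of the
supports, even though joins need not exist in general. -/
theorem IsSum.supp_le_iff {a b c : M.Elem} (h : IsSum a b c) {σ : K.Cell} :
    supp c ≤ σ ↔ supp a ≤ σ ∧ supp b ≤ σ := by
  simp only [← memCell_iff]
  constructor
  · exact fun hc => ⟨h.memCell_left hc, h.symm.memCell_left hc⟩
  · rintro ⟨⟨x, hx⟩, ⟨y, hy⟩⟩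
    exact ⟨x + y, isSum_unique ⟨σ, x, y, hx, hy, rfl⟩ h⟩

theorem IsSum.supp_left_le {a b c : M.Elem} (h : IsSum a b c) : supp a ≤ supp c :=
  (h.supp_le_iff.1 le_rfl).1

theorem IsSum.supp_right_le {a b c : M.Elem} (h : IsSum a b c) : supp b ≤ supp c :=
  (h.supp_le_iff.1 le_rfl).2

theorem IsSum.supp_eq_left {a b c : M.Elem} (h : IsSum a b c) (hba : supp b ≤ supp a) :
    supp c = supp a :=
  le_antisymm (h.supp_le_iff.2 ⟨le_rfl, hba⟩) h.supp_left_le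

theorem exists_isSum {a b : M.Elem} {σ : K.Cell} (ha : supp a ≤ σ) (hb : supp b ≤ σ) :
    ∃ c, IsSum a b c := by
  obtain ⟨x, hx⟩ := memCell_iff.2 ha
  obtain ⟨y, hy⟩ := memCell_iff.2 hb
  exact ⟨_, σ, x, y, hx, hy, rfl⟩

/-- Cancellation: both sums can be computed in the monoid of `supp c`, which lies in a group. A
homogeneous element therefore has at most one monomial multiple to consider in each degree. -/
theorem IsSum.left_unique {a a' b c : M.Elem} (h : IsSum a b c) (h' : IsSum a' b c) : a = a' := by
  obtain ⟨x, rfl⟩ := memCell_iff.2 h.supp_left_le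
  obtain ⟨x', rfl⟩ := memCell_iff.2 h'.supp_left_le
  obtain ⟨y, rfl⟩ := memCell_iff.2 h.supp_right_le
  have e : M.elem (supp c) (x + y) = M.elem (supp c) (x' + y) :=
    (isSum_unique ⟨_, x, y, rfl, rfl, rfl⟩ h).trans
      (isSum_unique ⟨_, x', y, rfl, rfl, rfl⟩ h').symm
  have e' : (x : Fin (supp c).rank → ℝ) + y = x' + y :=
    congrArg Subtype.val (elem_injective _ e)
  rw [Subtype.ext (add_right_cancel e')]

theorem supp_zeroElem_le (σ : K.Cell) : supp M.zeroElem ≤ σ :=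
  memCell_iff.1 ⟨0, elem_zero σ⟩

theorem IsSum.toDeg {a b c : M.Elem} (h : IsSum a b c) :
    IsDegSum a (M.toDeg b) (M.toDeg c) := by
  obtain ⟨σ, x, y, hx, rfl, rfl⟩ := h
  exact ⟨σ, x, M.toGroup y, hx, rfl, rfl⟩

theorem not_memCell_of_not_isSum {a b : M.Elem} (h : ¬ ∃ c, IsSum a b c) :
    ¬ ∃ σ, MemCell a σ ∧ DegMemCell (M.toDeg b) σ := by
  rintro ⟨σ, ⟨x, hx⟩, ⟨y, hy⟩⟩
  obtain ⟨y', -, hy'⟩ := mem_of_degree_eq hy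
  exact h ⟨_, σ, x, y', hx, hy', rfl⟩

/-! ### Generators of the monoids and their supports -/

theorem exists_finset_closure (M : MonoidalComplex C) (σ : K.Cell) :
    ∃ T : Finset (M.monoid σ), AddSubmonoid.closure (T : Set (M.monoid σ)) = ⊤ := by
  have h : AddMonoid.FG (M.monoid σ) := (AddMonoid.fg_iff_addSubmonoid_fg _).2 (M.fg_monoid σ)
  exact h.fg_top

theorem supp_elem_add_le_iff {σ ρ : K.Cell} (x y : M.monoid σ) :
    supp (M.elem σ (x + y)) ≤ ρ ↔ supp (M.elem σ x) ≤ ρ ∧ supp (M.elem σ y) ≤ ρ :=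
  IsSum.supp_le_iff ⟨σ, x, y, rfl, rfl, rfl⟩

theorem supp_elem_le_sum {σ : K.Cell} {S : Finset (M.monoid σ)} {x : M.monoid σ} (hx : x ∈ S) :
    supp (M.elem σ x) ≤ supp (M.elem σ (∑ y ∈ S, y)) := by
  classical
  rw [← Finset.add_sum_erase S (fun y => y) hx]
  exact ((supp_elem_add_le_iff _ _).1 le_rfl).1

/-- The sum of a finite set of generators of `M_σ` works: the face of its support contains every
generator, hence the whole cone. -/
theorem exists_supp_eq (M : MonoidalComplex C) (σ : K.Cell) : ∃ a : M.Elem, supp a = σ := by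
  obtain ⟨T, hT⟩ := exists_finset_closure M σ
  refine ⟨M.elem σ (∑ y ∈ T, y), le_antisymm (supp_elem_le _) ?_⟩
  set ρ := supp (M.elem σ (∑ y ∈ T, y)) with hρ
  have hρσ : ρ ≤ σ := supp_elem_le _
  have hall : ∀ x : M.monoid σ, supp (M.elem σ x) ≤ ρ := by
    intro x
    have hx : x ∈ AddSubmonoid.closure (T : Set (M.monoid σ)) := by rw [hT]; trivial
    induction hx using AddSubmonoid.closure_induction with
    | mem x hx => exact supp_elem_le_sum hx
    | zero => rw [elem_zero]; exact supp_zeroElem_le ρ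
    | add x y _ _ hx hy => exact (supp_elem_add_le_iff x y).2 ⟨hx, hy⟩
  refine le_of_map_le (C := C) (le_refl σ) hρσ ((C.isFaceOf (le_refl σ)).le.trans ?_)
  rw [← M.hull_monoid σ]
  refine Submodule.span_le.2 fun x hx => ?_
  exact (memCell_elem_iff hρσ ⟨x, hx⟩).1 (memCell_iff.2 (hall ⟨x, hx⟩))

/-- An element of `|M|` with support `σ`. -/
noncomputable def interiorElem (M : MonoidalComplex C) (σ : K.Cell) : M.Elem :=
  (exists_supp_eq M σ).choose

@[simp]
theorem supp_interiorElem (σ : K.Cell) : supp (M.interiorElem σ) = σ :=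
  (exists_supp_eq M σ).choose_spec

/-- Write `x` as a sum of generators. The generators that occur, taken once each, already have the
support of `x`; the repetitions are collected in `y`. -/
theorem exists_subset_sum_supp_eq {σ : K.Cell} {T : Finset (M.monoid σ)}
    (hT : AddSubmonoid.closure (T : Set (M.monoid σ)) = ⊤) (x : M.monoid σ) :
    ∃ S ⊆ T, ∃ y, x = y + ∑ z ∈ S, z ∧
      supp (M.elem σ (∑ z ∈ S, z)) = supp (M.elem σ x) := by
  classical
  have hx : x ∈ AddSubmonoid.closure (T : Set (M.monoid σ)) := by rw [hT]; trivial
  induction hx using AddSubmonoid.closure_induction_right with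
  | zero => exact ⟨∅, Finset.empty_subset _, 0, by simp, by simp⟩
  | add_right x _ t ht ih =>
    obtain ⟨S, hS, y, hy, hsupp⟩ := ih
    by_cases htS : t ∈ S
    -- A repeated generator goes into `y`. Its support already lies below that of the sum over `S`,
    -- so the join is unchanged.
    · refine ⟨S, hS, y + t, by rw [hy]; abel, eq_of_forall_ge_iff fun ρ => ?_⟩
      rw [supp_elem_add_le_iff, hsupp]
      exact ⟨fun h => ⟨h, (hsupp ▸ supp_elem_le_sum htS).trans h⟩, And.left⟩
    · refine ⟨insert t S, Finset.insert_subset ht hS, y, ?_, eq_of_forall_ge_iff fun ρ => ?_⟩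
      · rw [Finset.sum_insert htS, hy]; abel
      · rw [Finset.sum_insert htS, supp_elem_add_le_iff, supp_elem_add_le_iff, hsupp, and_comm]

/-- Up to addition of elements that do not change the support, `|M|` is finite. -/
theorem exists_finset_isSum (M : MonoidalComplex C) :
    ∃ G : Finset M.Elem, ∀ a, ∃ g ∈ G, supp g = supp a ∧ ∃ b, IsSum b g a := by
  classical
  choose T hT using exists_finset_closure M
  refine ⟨Finset.univ.biUnion fun σ => (T σ).powerset.image fun S => M.elem σ (∑ z ∈ S, z),
    fun a => ?_⟩
  obtain ⟨σ, x, rfl⟩ := exists_memCell a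
  obtain ⟨S, hS, y, hy, hsupp⟩ := exists_subset_sum_supp_eq (hT σ) x
  refine ⟨M.elem σ (∑ z ∈ S, z), ?_, hsupp, M.elem σ y, σ, y, _, rfl, rfl, by rw [← hy]⟩
  exact Finset.mem_biUnion.2 ⟨σ, Finset.mem_univ _,
    Finset.mem_image.2 ⟨S, Finset.mem_powerset.2 hS, rfl⟩⟩

end MonoidalComplex

/-! ### Homogeneous components of squarefree modules -/

namespace SquarefreeModuleCat

open MonoidalComplex ToricFaceRing

variable {X : Type v} [TopologicalSpace X] {K : RegularCellComplex X} {C : ConicalComplex K}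
  {M : MonoidalComplex C} {k : Type u} [Field k]

section Components

variable (N : SquarefreeModuleCat k M)

/-- The component of `N` of degree `a ∈ |M|`. -/
def comp (a : M.Elem) : Submodule k N.obj.carrier := N.obj.deg (M.toDeg a)

variable {N}

theorem t_smul_mem {a b c : M.Elem} (h : IsSum b a c) {m : N.obj.carrier} (hm : m ∈ comp N a) :
    t k b • m ∈ comp N c :=
  N.obj.smul_mem _ _ _ h.toDeg m hm

theorem t_smul_eq_zero {a b : M.Elem} (h : ¬ ∃ c, IsSum b a c) {m : N.obj.carrier}
    (hm : m ∈ comp N a) : t k b • m = 0 :=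
  N.obj.smul_eq_zero _ _ (not_memCell_of_not_isSum h) m hm

theorem t_zeroElem_smul (m : N.obj.carrier) : t k M.zeroElem • m = m := one_smul _ m

theorem t_smul_t_smul {a b c : M.Elem} (h : IsSum a b c) (m : N.obj.carrier) :
    t k a • t k b • m = t k c • m := by
  rw [smul_smul, t_mul_t k h]

open Classical in
-- Components outside `|M|` vanish and `|M|` embeds into `|ℤM|`, so the grading by `|ℤM|` may be
-- replaced by one by `|M|`.
theorem comp_isInternal (N : SquarefreeModuleCat k M) : DirectSum.IsInternal (comp N) := by
  have h := (DirectSum.isInternal_submodule_iff_iSupIndep_and_iSup_eq_top _).1 N.obj.isInternal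
  refine (DirectSum.isInternal_submodule_iff_iSupIndep_and_iSup_eq_top _).2
    ⟨h.1.comp toDeg_injective, ?_⟩
  rw [eq_top_iff, ← h.2]
  refine iSup_le fun c => ?_
  by_cases hc : c ∈ Set.range M.toDeg
  · obtain ⟨a, rfl⟩ := hc
    exact le_iSup (comp N) a
  · rw [N.property.2.1 c hc]
    exact bot_le

open Classical in
/-- The linear map with given restrictions to the components. -/
noncomputable def lift {P : Type*} [AddCommGroup P] [Module k P] (f : ∀ a, comp N a →ₗ[k] P) :
    N.obj.carrier →ₗ[k] P :=
  (DirectSum.toModule k M.Elem P f).comp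
    (LinearEquiv.ofBijective (DirectSum.coeLinearMap (comp N)) (comp_isInternal N)).symm.toLinearMap

theorem lift_apply {P : Type*} [AddCommGroup P] [Module k P] (f : ∀ a, comp N a →ₗ[k] P)
    {a : M.Elem} (m : comp N a) : lift f (m : N.obj.carrier) = f a m := by
  classical
  have h : (LinearEquiv.ofBijective (DirectSum.coeLinearMap (comp N)) (comp_isInternal N)).symm m =
      DirectSum.lof k M.Elem (fun a => comp N a) a m := by
    rw [LinearEquiv.symm_apply_eq]
    exact (DirectSum.coeLinearMap_lof (comp N) a m).symm
  unfold lift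
  rw [LinearMap.comp_apply, LinearEquiv.coe_coe, h, DirectSum.toModule_lof]

theorem comp_induction {P : N.obj.carrier → Prop} (h0 : P 0)
    (hadd : ∀ x y, P x → P y → P (x + y)) (hcomp : ∀ a, ∀ m ∈ comp N a, P m)
    (m : N.obj.carrier) : P m := by
  classical
  have hm : m ∈ ⨆ a, comp N a := by
    rw [((DirectSum.isInternal_submodule_iff_iSupIndep_and_iSup_eq_top _).1
      (comp_isInternal N)).2]
    trivial
  exact Submodule.iSup_induction _ (motive := P) hm hcomp h0 hadd

end Components

/-! ### Morphisms given componentwise -/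

section Homs

variable {A B D : SquarefreeModuleCat k M}

/-- The linear map underlying a morphism. -/
def app (f : A ⟶ B) : A.obj.carrier →ₗ[ToricFaceRing k M] B.obj.carrier :=
  ZGradedModule.Hom.toLinearMap f.hom

theorem app_mem (f : A ⟶ B) {a : M.Elem} {m : A.obj.carrier} (hm : m ∈ comp A a) :
    app f m ∈ comp B a :=
  ZGradedModule.Hom.map_deg f.hom _ m hm

theorem app_injective : Function.Injective (app : (A ⟶ B) → _) := fun _ _ h =>
  ObjectProperty.hom_ext _ (ZGradedModule.Hom.ext h)

@[simp]
theorem app_comp (f : A ⟶ B) (g : B ⟶ D) (m : A.obj.carrier) : app (f ≫ g) m = app g (app f m) :=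
  rfl

@[simp]
theorem app_id (m : A.obj.carrier) : app (𝟙 A) m = m := rfl

@[simp]
theorem app_add (f g : A ⟶ B) (m : A.obj.carrier) : app (f + g) m = app f m + app g m := rfl

theorem app_sum {ι : Type*} (s : Finset ι) (f : ι → (A ⟶ B)) (m : A.obj.carrier) :
    app (∑ i ∈ s, f i) m = ∑ i ∈ s, app (f i) m := by
  classical
  induction s using Finset.induction_on with
  | empty => rfl
  | insert i s hi ih => rw [Finset.sum_insert hi, Finset.sum_insert hi, app_add, ih]

theorem hom_ext_comp {f g : A ⟶ B} (h : ∀ a, ∀ m ∈ comp A a, app f m = app g m) : f = g := by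
  apply app_injective
  ext m
  refine comp_induction (P := fun m => app f m = app g m) ?_ ?_ h m
  · rw [map_zero, map_zero]
  · intro x y hx hy
    rw [map_add, map_add, hx, hy]

/-- A family of maps between the components that commutes with the monomials is a morphism. -/
noncomputable def ofComponents (f : ∀ a, comp A a →ₗ[k] comp B a)
    (hf : ∀ (a b c : M.Elem) (h : IsSum b a c) (m : comp A a),
      (f c ⟨t k b • (m : A.obj.carrier), t_smul_mem h m.2⟩ : B.obj.carrier) =
        t k b • (f a m : B.obj.carrier)) : A ⟶ B :=
  ⟨{ toLinearMap :=
      { toFun := lift fun a => (comp B a).subtype.comp (f a)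
        map_add' := map_add _
        map_smul' := by
          intro r m
          refine comp_induction (P := fun m => lift (fun a => (comp B a).subtype.comp (f a)) (r • m)
            = r • lift (fun a => (comp B a).subtype.comp (f a)) m) ?_ ?_ ?_ m
          · rw [smul_zero, map_zero, smul_zero]
          · intro x y hx hy
            rw [smul_add, map_add, map_add, hx, hy, smul_add]
          · intro a m hm
            induction r using induction_t k with
            | h0 => rw [zero_smul, zero_smul, map_zero]
            -- By additivity, linearity over `R` need only be checked for monomials acting on
            -- homogeneous elements. Where the sum of degrees is undefined, both sides vanish.
            | hadd r s hr hs => rw [add_smul, map_add, hr, hs, add_smul]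
            | ht s b =>
              rw [smul_assoc, smul_assoc, map_smul]
              congr 1
              rw [lift_apply _ (⟨m, hm⟩ : comp A a), LinearMap.comp_apply, Submodule.subtype_apply]
              by_cases h : ∃ c, IsSum b a c
              · obtain ⟨c, h⟩ := h
                rw [lift_apply _ (⟨t k b • m, t_smul_mem h hm⟩ : comp A c)]
                exact hf a b c h ⟨m, hm⟩
              · rw [t_smul_eq_zero h hm, t_smul_eq_zero h (f a ⟨m, hm⟩).2, map_zero] }
     map_deg := by
      intro c m hm
      by_cases hc : c ∈ Set.range M.toDeg
      · obtain ⟨a, rfl⟩ := hc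
        change lift _ m ∈ comp B a
        rw [lift_apply _ (⟨m, hm⟩ : comp A a)]
        exact (f a ⟨m, hm⟩).2
      · rw [A.property.2.1 c hc, Submodule.mem_bot] at hm
        change lift _ m ∈ B.obj.deg c
        rw [hm, map_zero]
        exact zero_mem _ }⟩

theorem app_ofComponents (f : ∀ a, comp A a →ₗ[k] comp B a) (hf) {a : M.Elem} (m : comp A a) :
    app (ofComponents f hf) (m : A.obj.carrier) = f a m :=
  lift_apply _ m

/-- A family of bijections between the components that commutes with the monomials is an
isomorphism. -/
noncomputable def isoOfComponents (f : ∀ a, comp A a ≃ₗ[k] comp B a)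
    (hf : ∀ (a b c : M.Elem) (h : IsSum b a c) (m : comp A a),
      (f c ⟨t k b • (m : A.obj.carrier), t_smul_mem h m.2⟩ : B.obj.carrier) =
        t k b • (f a m : B.obj.carrier)) : A ≅ B where
  hom := ofComponents (fun a => (f a).toLinearMap) hf
  inv := ofComponents (fun a => (f a).symm.toLinearMap) (by
    intro a b c h m
    obtain ⟨m, rfl⟩ := (f a).surjective m
    have := hf a b c h m
    have h' : (⟨t k b • (f a m : B.obj.carrier), t_smul_mem h (f a m).2⟩ : comp B c) =
      f c ⟨t k b • (m : A.obj.carrier), t_smul_mem h m.2⟩ := Subtype.ext this.symm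
    simp only [LinearEquiv.coe_coe, LinearEquiv.symm_apply_apply]
    rw [h', LinearEquiv.symm_apply_apply])
  hom_inv_id := hom_ext_comp fun a m hm => by
    rw [app_comp, app_id, app_ofComponents _ _ (⟨m, hm⟩ : comp A a), app_ofComponents]
    simp
  inv_hom_id := hom_ext_comp fun a m hm => by
    rw [app_comp, app_id, app_ofComponents _ _ (⟨m, hm⟩ : comp B a), app_ofComponents]
    simp

end Homs

/-! ### Transport between components -/

section Transport

variable {N : SquarefreeModuleCat k M}

/-- The squarefree condition in the form used below: since supports of sums are joins, `supp (a + b)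
= supp a` amounts to `supp b ≤ supp a`. -/
theorem bijOn_t_smul {a b c : M.Elem} (h : IsSum b a c) (hba : supp b ≤ supp a) :
    Set.BijOn (fun m : N.obj.carrier => t k b • m) (comp N a) (comp N c) :=
  N.property.2.2 a b c (supp a) h.symm (isSupp_supp a)
    (by rw [← h.symm.supp_eq_left hba]; exact isSupp_supp c)

theorem t_smul_injOn {a b : M.Elem} (hba : supp b ≤ supp a) {m m' : N.obj.carrier}
    (hm : m ∈ comp N a) (hm' : m' ∈ comp N a) (h : t k b • m = t k b • m') : m = m' := by
  obtain ⟨c, hc⟩ := exists_isSum hba le_rfl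
  exact (bijOn_t_smul hc hba).injOn hm hm' h

/-- The element `t^b m` has degree `a + b`, whose support is `supp b`. There `t^a` can be divided
out. -/
theorem exists_transport {a b : M.Elem} (h : supp a ≤ supp b) {m : N.obj.carrier}
    (hm : m ∈ comp N a) : ∃ z ∈ comp N b, t k a • z = t k b • m := by
  obtain ⟨c, hc⟩ := exists_isSum h le_rfl
  exact (bijOn_t_smul hc h).surjOn (t_smul_mem hc.symm hm)

variable (N)

open Classical in
/-- The canonical map `N_a → N_b` if `supp a ≤ supp b`; it is `0` otherwise. -/
noncomputable def transport (a b : M.Elem) : comp N a →ₗ[k] comp N b :=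
  if h : supp a ≤ supp b then
    { toFun := fun m => ⟨(exists_transport h m.2).choose, (exists_transport h m.2).choose_spec.1⟩
      map_add' := fun x y => Subtype.ext <| t_smul_injOn h
        (exists_transport h (x + y).2).choose_spec.1
        (add_mem (exists_transport h x.2).choose_spec.1 (exists_transport h y.2).choose_spec.1) (by
          rw [(exists_transport h (x + y).2).choose_spec.2, Submodule.coe_add, Submodule.coe_add,
            smul_add, smul_add, (exists_transport h x.2).choose_spec.2,
            (exists_transport h y.2).choose_spec.2])
      map_smul' := fun r x => Subtype.ext <| t_smul_injOn h
        (exists_transport h (r • x).2).choose_spec.1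
        (Submodule.smul_mem _ r (exists_transport h x.2).choose_spec.1) (by
          rw [(exists_transport h (r • x).2).choose_spec.2, RingHom.id_apply, Submodule.coe_smul,
            Submodule.coe_smul, smul_comm (t k a) r, (exists_transport h x.2).choose_spec.2,
            smul_comm (t k b) r]) }
  else 0

variable {N}

theorem t_smul_transport {a b : M.Elem} (h : supp a ≤ supp b) (m : comp N a) :
    t k a • (transport N a b m : N.obj.carrier) = t k b • (m : N.obj.carrier) := by
  rw [transport, dif_pos h]
  exact (exists_transport h m.2).choose_spec.2

theorem transport_of_not {a b : M.Elem} (h : ¬ supp a ≤ supp b) : transport N a b = 0 := by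
  rw [transport, dif_neg h]

theorem eq_transport {a b : M.Elem} (h : supp a ≤ supp b) {m : comp N a} {z : comp N b}
    (hz : t k a • (z : N.obj.carrier) = t k b • (m : N.obj.carrier)) : z = transport N a b m :=
  Subtype.ext (t_smul_injOn h z.2 (transport N a b m).2 (hz.trans (t_smul_transport h m).symm))

@[simp]
theorem transport_self (a : M.Elem) (m : comp N a) : transport N a a m = m :=
  (eq_transport le_rfl rfl).symm

theorem transport_transport {a b c : M.Elem} (hab : supp a ≤ supp b) (hbc : supp b ≤ supp c)
    (m : comp N a) : transport N b c (transport N a b m) = transport N a c m := by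
  refine eq_transport (hab.trans hbc) ?_
  obtain ⟨d, hd⟩ := exists_isSum (hab.trans hbc) le_rfl
  have hz := t_smul_mem hd (transport N b c (transport N a b m)).2
  -- Both sides have degree `d = a + c`. Multiplication by `t^b` is injective there because `supp b
  -- ≤ supp c ≤ supp d`, and after it the two defining equations of transport apply.
  refine t_smul_injOn (b := b) ?_ hz (t_smul_mem hd.symm m.2) ?_
  · exact hbc.trans hd.supp_right_le
  · rw [smul_comm, t_smul_transport hbc, smul_comm, t_smul_transport hab, smul_comm]

/-- Monomials act by transport, so the `R`-module structure is determined by the transport maps. -/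
theorem transport_isSum {a b c : M.Elem} (h : IsSum b a c) (m : comp N a) :
    transport N a c m = ⟨t k b • (m : N.obj.carrier), t_smul_mem h m.2⟩ :=
  (eq_transport h.supp_right_le (t_smul_t_smul h.symm _)).symm

/-- The map on components induced by a morphism. -/
noncomputable def appComp {A B : SquarefreeModuleCat k M} (f : A ⟶ B) (a : M.Elem) :
    comp A a →ₗ[k] comp B a :=
  ((app f).restrictScalars k).restrict fun _ hm => app_mem f hm

@[simp]
theorem coe_appComp {A B : SquarefreeModuleCat k M} (f : A ⟶ B) {a : M.Elem} (m : comp A a) :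
    (appComp f a m : B.obj.carrier) = app f m := rfl

/-- A morphism commutes with `t^a` and `t^b`, and the quotient by `t^a` is unique. -/
theorem appComp_transport {A B : SquarefreeModuleCat k M} (f : A ⟶ B) (a b : M.Elem)
    (m : comp A a) : appComp f b (transport A a b m) = transport B a b (appComp f a m) := by
  by_cases h : supp a ≤ supp b
  · refine eq_transport h ?_
    rw [coe_appComp, ← map_smul, t_smul_transport h, map_smul, coe_appComp]
  · rw [transport_of_not h, transport_of_not h, LinearMap.zero_apply, map_zero,
      LinearMap.zero_apply]

/-- The components whose degrees have the same support are isomorphic. -/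
noncomputable def transportEquiv (N : SquarefreeModuleCat k M) {a b : M.Elem}
    (h : supp a = supp b) : comp N a ≃ₗ[k] comp N b :=
  LinearEquiv.ofLinearMap (transport N a b) (transport N b a)
    (LinearMap.ext fun m => by simp [transport_transport h.ge h.le])
    (LinearMap.ext fun m => by simp [transport_transport h.le h.ge])

/-- A morphism is determined by its values in the degrees `interiorElem σ`. -/
theorem hom_ext_interiorElem {A B : SquarefreeModuleCat k M} {f g : A ⟶ B}
    (h : ∀ σ : K.Cell, ∀ m ∈ comp A (M.interiorElem σ), app f m = app g m) : f = g := by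
  refine hom_ext_comp fun a m hm => ?_
  have hs : supp a = supp (M.interiorElem (supp a)) := (supp_interiorElem _).symm
  have e : appComp f a ⟨m, hm⟩ = appComp g a ⟨m, hm⟩ := by
    apply (transportEquiv B hs).injective
    change transport B _ _ _ = transport B _ _ _
    rw [← appComp_transport, ← appComp_transport]
    exact Subtype.ext (h _ _ (transport A _ _ _).2)
  exact congrArg Subtype.val e

end Transport

/-! ### Finite-dimensionality of the components -/

section Finite

theorem exists_finset_homogeneous (N : SquarefreeModuleCat k M) :
    ∃ H : Finset N.obj.carrier, (∀ h ∈ H, ∃ a, h ∈ comp N a) ∧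
      Submodule.span (ToricFaceRing k M) (H : Set N.obj.carrier) = ⊤ := by
  have htop : Submodule.span (ToricFaceRing k M) {m : N.obj.carrier | ∃ a, m ∈ comp N a} = ⊤ := by
    rw [eq_top_iff]
    rintro m -
    exact comp_induction (P := fun m => m ∈ Submodule.span (ToricFaceRing k M)
      {m : N.obj.carrier | ∃ a, m ∈ comp N a}) (zero_mem _)
      (fun _ _ => add_mem) (fun a m hm => Submodule.subset_span ⟨a, hm⟩) m
  have hfg : (Submodule.span (ToricFaceRing k M)
      {m : N.obj.carrier | ∃ a, m ∈ comp N a}).FG := by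
    rw [htop]
    exact N.property.1.fg_top
  obtain ⟨H, hH, hspan⟩ := (Submodule.fg_span_iff_fg_span_finset_subset _).1 hfg
  exact ⟨H, fun h hh => hH hh, by rw [← hspan, htop]⟩

instance finite_comp (N : SquarefreeModuleCat k M) (a : M.Elem) : Module.Finite k (comp N a) := by
  classical
  obtain ⟨H, hH, hspan⟩ := exists_finset_homogeneous N
  -- The projection onto the component of degree `a`.
  let π : N.obj.carrier →ₗ[k] N.obj.carrier :=
    lift fun b => if b = a then (comp N b).subtype else 0
  have hπ : ∀ m ∈ comp N a, π m = m := by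
    intro m hm
    change lift _ m = m
    rw [lift_apply _ (⟨m, hm⟩ : comp N a), if_pos rfl]
    rfl
  have hπ' : ∀ b, b ≠ a → ∀ m ∈ comp N b, π m = 0 := by
    intro b hb m hm
    change lift _ m = 0
    rw [lift_apply _ (⟨m, hm⟩ : comp N b), if_neg hb]
    rfl
  have : Nonempty M.Elem := ⟨a⟩
  choose! d hd using hH
  -- The monomial multiples of the generators that land in degree `a`. By cancellation each
  -- generator contributes at most one, so `T` is finite.
  let T : Set N.obj.carrier := ⋃ h ∈ H, {x | ∃ b, IsSum b (d h) a ∧ x = t k b • h}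
  have hT : T.Finite := by
    refine H.finite_toSet.biUnion fun h _ => Set.Subsingleton.finite ?_
    rintro _ ⟨b, hb, rfl⟩ _ ⟨b', hb', rfl⟩
    rw [hb.left_unique hb']
  -- The free monomial factor `t^b` absorbs the coefficients in the induction over the span; `b = 0`
  -- is the case needed in the end.
  have key : ∀ m : N.obj.carrier, ∀ b : M.Elem, π (t k b • m) ∈ Submodule.span k T := by
    intro m
    have hm : m ∈ Submodule.span (ToricFaceRing k M) (H : Set N.obj.carrier) := by
      rw [hspan]; trivial
    induction hm using Submodule.span_induction with
    | mem h hh =>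
      intro b
      by_cases hs : ∃ c, IsSum b (d h) c
      · obtain ⟨c, hc⟩ := hs
        have hmem := t_smul_mem hc (hd h hh)
        by_cases hca : c = a
        · subst hca
          rw [hπ _ hmem]
          exact Submodule.subset_span (Set.mem_biUnion hh ⟨b, hc, rfl⟩)
        · rw [hπ' c hca _ hmem]
          exact zero_mem _
      · rw [t_smul_eq_zero hs (hd h hh), map_zero]
        exact zero_mem _
    | zero => intro b; rw [smul_zero, map_zero]; exact zero_mem _
    | add x y _ _ hx hy => intro b; rw [smul_add, map_add]; exact add_mem (hx b) (hy b)
    | smul r x _ hx =>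
      intro b
      induction r using induction_t k with
      | h0 => rw [zero_smul, smul_zero, map_zero]; exact zero_mem _
      | hadd r s hr hs => rw [add_smul, smul_add, map_add]; exact add_mem hr hs
      | ht s c =>
        rw [smul_assoc, smul_comm, map_smul]
        refine Submodule.smul_mem _ s ?_
        rw [smul_smul]
        by_cases hs : ∃ e, IsSum b c e
        · obtain ⟨e, he⟩ := hs
          rw [t_mul_t k he]
          exact hx e
        · rw [t_mul_t_of_not k hs, zero_smul, map_zero]
          exact zero_mem _
  have hle : comp N a ≤ Submodule.span k T := by
    intro m hm
    have := key m M.zeroElem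
    rwa [t_zeroElem_smul, hπ m hm] at this
  have : Module.Finite k (Submodule.span k T) := Module.Finite.span_of_finite k hT
  exact Submodule.finiteDimensional_of_le hle

end Finite

end SquarefreeModuleCat

/-! ### The incidence algebra and its basis -/

namespace CellIncidenceAlgebra

open OrderDual

variable {X : Type v} [TopologicalSpace X] {K : RegularCellComplex X} {k : Type u} [Field k]

/-- The coefficient of `e_{σ,τ}`. -/
def coeff (f : CellIncidenceAlgebra K k) (σ τ : K.Cell) : k := f (toDual σ) (toDual τ)

theorem coeff_of_not {f : CellIncidenceAlgebra K k} {σ τ : K.Cell} (h : ¬ τ ≤ σ) :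
    coeff f σ τ = 0 :=
  IncidenceAlgebra.apply_eq_zero_of_not_le (by exact h) f

theorem coeff_ext {f g : CellIncidenceAlgebra K k} (h : ∀ σ τ, coeff f σ τ = coeff g σ τ) :
    f = g :=
  IncidenceAlgebra.ext fun x y _ => h (ofDual x) (ofDual y)

theorem coeff_add (f g : CellIncidenceAlgebra K k) (σ τ : K.Cell) :
    coeff (f + g) σ τ = coeff f σ τ + coeff g σ τ := rfl

theorem coeff_zero (σ τ : K.Cell) : coeff (0 : CellIncidenceAlgebra K k) σ τ = 0 := rfl

theorem coeff_sum {ι : Type*} (s : Finset ι) (f : ι → CellIncidenceAlgebra K k) (σ τ : K.Cell) :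
    coeff (∑ i ∈ s, f i) σ τ = ∑ i ∈ s, coeff (f i) σ τ := by
  classical
  induction s using Finset.induction_on with
  | empty => rfl
  | insert i s hi ih => rw [Finset.sum_insert hi, Finset.sum_insert hi, coeff_add, ih]

theorem coeff_smul (r : k) (f : CellIncidenceAlgebra K k) (σ τ : K.Cell) :
    coeff (r • f) σ τ = r * coeff f σ τ := rfl

theorem coeff_one (σ τ : K.Cell) :
    coeff (1 : CellIncidenceAlgebra K k) σ τ = if σ = τ then 1 else 0 := rfl

/-- The defining sum over an interval extends to all cells, since outside the interval one of the
two coefficients vanishes. -/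
theorem coeff_mul (f g : CellIncidenceAlgebra K k) (σ υ : K.Cell) :
    coeff (f * g) σ υ = ∑ τ : K.Cell, coeff f σ τ * coeff g τ υ := by
  have h : coeff (f * g) σ υ =
      ∑ τ ∈ Finset.Icc (toDual σ) (toDual υ), coeff f σ (ofDual τ) * coeff g (ofDual τ) υ := rfl
  rw [h, Finset.sum_subset (Finset.subset_univ _)]
  · exact Fintype.sum_equiv ofDual _ _ fun _ => rfl
  · intro τ _ hτ
    rw [Finset.mem_Icc, not_and_or] at hτ
    rcases hτ with h | h
    · rw [coeff_of_not (f := f) (by exact h), zero_mul]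
    · rw [coeff_of_not (f := g) (by exact h), mul_zero]

variable (k) in
open Classical in
/-- The basis element `e_{σ,τ}` if `τ ≤ σ`, and `0` otherwise. -/
noncomputable def e (σ τ : K.Cell) : CellIncidenceAlgebra K k :=
  ⟨fun x y => if ofDual x = σ ∧ ofDual y = τ ∧ τ ≤ σ then 1 else 0, fun x y hxy => if_neg (by
    rintro ⟨rfl, rfl, h⟩
    exact hxy h)⟩

open Classical in
theorem coeff_e (σ τ x y : K.Cell) :
    coeff (e k σ τ) x y = if x = σ ∧ y = τ ∧ τ ≤ σ then 1 else 0 := rfl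

theorem e_of_not {σ τ : K.Cell} (h : ¬ τ ≤ σ) : e k σ τ = 0 :=
  coeff_ext fun x y => by rw [coeff_e, if_neg (fun h' => h h'.2.2), coeff_zero]

theorem e_mul_e {σ τ υ : K.Cell} (h : τ ≤ σ) (h' : υ ≤ τ) : e k σ τ * e k τ υ = e k σ υ := by
  classical
  refine coeff_ext fun x y => ?_
  rw [coeff_mul, Finset.sum_eq_single τ]
  · by_cases hx : x = σ <;> simp [coeff_e, h, h', h'.trans h, hx]
  · intro z _ hz
    simp [coeff_e, hz]
  · simp

theorem e_mul_e_of_ne {σ τ τ' υ : K.Cell} (h : τ ≠ τ') : e k σ τ * e k τ' υ = 0 := by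
  refine coeff_ext fun x y => ?_
  rw [coeff_mul, coeff_zero]
  refine Finset.sum_eq_zero fun z _ => ?_
  by_cases hz : z = τ
  · simp [coeff_e, hz, h]
  · simp [coeff_e, hz]

/-- Together with `e_mul_e` and `e_mul_e_of_ne` this is a decomposition of `1` into orthogonal
idempotents, which splits every module into the parts `e_{σ,σ} N`. -/
theorem sum_e : ∑ σ : K.Cell, e k σ σ = 1 := by
  refine coeff_ext fun x y => ?_
  rw [coeff_sum, coeff_one, Finset.sum_eq_single x]
  · simp [coeff_e, eq_comm]
  · intro σ _ hσ
    simp [coeff_e, hσ.symm]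
  · simp

theorem eq_sum_e (f : CellIncidenceAlgebra K k) :
    f = ∑ σ : K.Cell, ∑ τ : K.Cell, coeff f σ τ • e k σ τ := by
  refine coeff_ext fun x y => ?_
  simp_rw [coeff_sum, coeff_smul]
  rw [Finset.sum_eq_single x, Finset.sum_eq_single y]
  · by_cases h : y ≤ x
    · simp [coeff_e, h]
    · simp [coeff_of_not h]
  · intro τ _ hτ
    simp [coeff_e, hτ.symm]
  · simp
  · intro σ _ hσ
    simp [coeff_e, hσ.symm]
  · simp

instance : IsScalarTower k (CellIncidenceAlgebra K k) (CellIncidenceAlgebra K k) :=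
  ⟨fun r f g => coeff_ext fun x y => by
    simp only [smul_eq_mul, coeff_mul, coeff_smul, Finset.mul_sum, mul_assoc]⟩

instance : Module.Finite k (CellIncidenceAlgebra K k) := by
  classical
  refine ⟨⟨Finset.univ.image fun p : K.Cell × K.Cell => e k p.1 p.2, ?_⟩⟩
  rw [eq_top_iff]
  rintro f -
  rw [eq_sum_e f]
  refine sum_mem fun σ _ => sum_mem fun τ _ => Submodule.smul_mem _ _ (Submodule.subset_span ?_)
  simp

/-- Makes the finitely generated modules over the incidence algebra an abelian category. -/
instance : IsNoetherianRing (CellIncidenceAlgebra K k) :=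
  isNoetherian_of_tower k inferInstance

end CellIncidenceAlgebra

/-! ### The squarefree module of sections of a `Λ`-module -/

namespace CellIncidenceAlgebra

variable {X : Type v} [TopologicalSpace X] {K : RegularCellComplex X} {C : ConicalComplex K}
  {M : MonoidalComplex C} {k : Type u} [Field k]

open MonoidalComplex ToricFaceRing

section Action

variable (k) (N : Type (max u v)) [AddCommGroup N] [Module k N]
  [Module (CellIncidenceAlgebra K k) N] [IsScalarTower k (CellIncidenceAlgebra K k) N]

/-- Multiplication by `e_{σ,τ}`. -/
noncomputable def eMap (σ τ : K.Cell) : N →ₗ[k] N where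
  toFun n := e k σ τ • n
  map_add' := smul_add _
  map_smul' r n := smul_algebra_smul_comm r (e k σ τ) n

variable {k N}

theorem eMap_apply (σ τ : K.Cell) (n : N) : eMap k N σ τ n = e k σ τ • n := rfl

theorem eMap_eMap {σ τ υ : K.Cell} (h : τ ≤ σ) (h' : υ ≤ τ) (n : N) :
    eMap k N σ τ (eMap k N τ υ n) = eMap k N σ υ n := by
  simp only [eMap_apply, smul_smul, e_mul_e h h']

variable (k N)

open Classical in
/-- Multiplication by `t^b` on `N`-valued functions on `|M|`. -/
noncomputable def act (b : M.Elem) : (M.Elem →₀ N) →ₗ[k] (M.Elem →₀ N) :=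
  Finsupp.lsum k fun a => if h : ∃ c, IsSum b a c then
    (Finsupp.lsingle h.choose).comp (eMap k N (supp h.choose) (supp a)) else 0

variable {k N}

theorem act_single {a b c : M.Elem} (h : IsSum b a c) (n : N) :
    act k N b (Finsupp.single a n) = Finsupp.single c (eMap k N (supp c) (supp a) n) := by
  have h' : ∃ c, IsSum b a c := ⟨c, h⟩
  rw [act, Finsupp.lsum_single, dif_pos h', isSum_unique h'.choose_spec h]
  rfl

theorem act_single_of_not {a b : M.Elem} (h : ¬ ∃ c, IsSum b a c) (n : N) :
    act k N b (Finsupp.single a n) = 0 := by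
  rw [act, Finsupp.lsum_single, dif_neg h]
  rfl

/-- Associativity of the partial addition on `|M|` matches the sums, and `e_{σ,τ} e_{τ,υ} = e_{σ,υ}`
matches the values. -/
theorem act_act {a b c : M.Elem} (h : IsSum a b c) (x : M.Elem →₀ N) :
    act k N a (act k N b x) = act k N c x := by
  induction x using Finsupp.induction_linear with
  | zero => simp only [map_zero]
  | add x y hx hy => simp only [map_add, hx, hy]
  | single d n =>
    by_cases hd : ∃ f, IsSum c d f
    · obtain ⟨f, hf⟩ := hd
      obtain ⟨g, hg, hg'⟩ := h.assoc hf
      rw [act_single hg, act_single hg', act_single hf,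
        eMap_eMap hg'.supp_right_le hg.supp_right_le]
    · rw [act_single_of_not hd]
      by_cases hg : ∃ g, IsSum b d g
      · obtain ⟨g, hg⟩ := hg
        rw [act_single hg, act_single_of_not]
        rintro ⟨f, hf⟩
        obtain ⟨c', hc', hf'⟩ := hg.symm.assoc hf.symm
        rw [isSum_unique hc'.symm h] at hf'
        exact hd ⟨f, hf'.symm⟩
      · rw [act_single_of_not hg, map_zero]

theorem act_act_of_not {a b : M.Elem} (h : ¬ ∃ c, IsSum a b c) (x : M.Elem →₀ N) :
    act k N a (act k N b x) = 0 := by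
  induction x using Finsupp.induction_linear with
  | zero => simp only [map_zero]
  | add x y hx hy => simp only [map_add, hx, hy, add_zero]
  | single d n =>
    by_cases hg : ∃ g, IsSum b d g
    · obtain ⟨g, hg⟩ := hg
      rw [act_single hg, act_single_of_not]
      rintro ⟨f, hf⟩
      obtain ⟨c', hc', -⟩ := hg.symm.assoc hf.symm
      exact h ⟨c', hc'.symm⟩
    · rw [act_single_of_not hg, map_zero]

variable (k N M)

/-- The linear extension of `act` to the toric face ring. -/
noncomputable def actLin : ToricFaceRing k M →ₗ[k] ((M.Elem →₀ N) →ₗ[k] (M.Elem →₀ N)) :=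
  (basis k).constr k (act k N)

variable {k N M}

theorem actLin_t (b : M.Elem) : actLin M k N (t k b) = act k N b := by
  rw [actLin, ← basis_apply, Module.Basis.constr_basis]

theorem actLin_mul (f g : ToricFaceRing k M) (x : M.Elem →₀ N) :
    actLin M k N (f * g) x = actLin M k N f (actLin M k N g x) := by
  induction f using induction_t k with
  | h0 => simp only [zero_mul, map_zero, LinearMap.zero_apply]
  | hadd f₁ f₂ h₁ h₂ => simp only [add_mul, map_add, LinearMap.add_apply, h₁, h₂]
  | ht r a =>
    induction g using induction_t k with
    | h0 => simp only [mul_zero, map_zero, LinearMap.zero_apply]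
    | hadd f₁ f₂ h₁ h₂ => simp only [mul_add, map_add, LinearMap.add_apply, h₁, h₂]
    | ht s b =>
      simp only [smul_mul_assoc, mul_smul_comm, map_smul, LinearMap.smul_apply, actLin_t]
      congr 2
      by_cases h : ∃ c, IsSum a b c
      · obtain ⟨c, h⟩ := h
        rw [t_mul_t k h, actLin_t, act_act h]
      · rw [t_mul_t_of_not k h, act_act_of_not h, map_zero, LinearMap.zero_apply]

/-- The unit of `R` acts at `a` as an idempotent and not as the identity. This is why the functions
have to be cut down to `sections`. -/
theorem actLin_one_apply (x : M.Elem →₀ N) (a : M.Elem) :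
    actLin M k N 1 x a = e k (supp a) (supp a) • x a := by
  rw [one_def, actLin_t]
  induction x using Finsupp.induction_linear with
  | zero => simp only [map_zero, Finsupp.zero_apply, smul_zero]
  | add x y hx hy => simp only [map_add, Finsupp.add_apply, hx, hy, smul_add]
  | single b n =>
    rw [act_single (isSum_zero b)]
    by_cases h : b = a
    · subst h
      rw [Finsupp.single_eq_same, Finsupp.single_eq_same, eMap_apply]
    · rw [Finsupp.single_eq_of_ne' h, Finsupp.single_eq_of_ne' h, smul_zero]

variable (k N M)

/-- The functions `x` on `|M|` with `x a ∈ e_{σ,σ} N` for all `a` with support `σ`. -/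
def sections : Submodule k (M.Elem →₀ N) where
  carrier := {x | ∀ a, e k (supp a) (supp a) • x a = x a}
  add_mem' hx hy a := by rw [Finsupp.add_apply, smul_add, hx, hy]
  zero_mem' a := by rw [Finsupp.zero_apply, smul_zero]
  smul_mem' r x hx a := by
    rw [Finsupp.smul_apply, smul_algebra_smul_comm, hx]

variable {k N M}

/-- The sections are the fixed points of the idempotent by which `1` acts, so `R` preserves them and
acts on them unitally. -/
theorem mem_sections_iff {x : M.Elem →₀ N} : x ∈ sections M k N ↔ actLin M k N 1 x = x := by
  rw [Finsupp.ext_iff]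
  simp only [actLin_one_apply]
  rfl

theorem actLin_mem (f : ToricFaceRing k M) (x : M.Elem →₀ N) :
    actLin M k N f x ∈ sections M k N := by
  rw [mem_sections_iff, ← actLin_mul, one_mul]

noncomputable instance : SMul (ToricFaceRing k M) (sections M k N) :=
  ⟨fun f x => ⟨actLin M k N f x.1, actLin_mem (N := N) f x.1⟩⟩

theorem coe_smul_sections (f : ToricFaceRing k M) (x : sections M k N) :
    ((f • x : sections M k N) : M.Elem →₀ N) = actLin M k N f x := rfl

noncomputable instance : Module (ToricFaceRing k M) (sections M k N) where
  one_smul x := Subtype.ext (mem_sections_iff.1 x.2)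
  mul_smul f g x := Subtype.ext (actLin_mul (N := N) f g x.1)
  smul_zero f := Subtype.ext (map_zero _)
  smul_add f x y := Subtype.ext (map_add _ _ _)
  add_smul f g x := Subtype.ext (by
    rw [coe_smul_sections, map_add, LinearMap.add_apply]; rfl)
  zero_smul x := Subtype.ext (by rw [coe_smul_sections, map_zero, LinearMap.zero_apply]; rfl)

instance : IsScalarTower k (ToricFaceRing k M) (sections M k N) :=
  ⟨fun r f x => Subtype.ext (by
    rw [coe_smul_sections, map_smul, LinearMap.smul_apply]; rfl)⟩

/-- The section supported at `a` with value `e_{σ,σ} n`, where `σ = supp a`. -/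
noncomputable def single (a : M.Elem) : N →ₗ[k] sections M k N :=
  ((Finsupp.lsingle a).comp (eMap k N (supp a) (supp a))).codRestrict _ fun n => by
    intro b
    by_cases h : a = b
    · subst h
      simp only [LinearMap.comp_apply, Finsupp.lsingle_apply, Finsupp.single_eq_same]
      exact eMap_eMap le_rfl le_rfl n
    · simp only [LinearMap.comp_apply, Finsupp.lsingle_apply]
      rw [Finsupp.single_eq_of_ne' h, smul_zero]

theorem coe_single (a : M.Elem) (n : N) :
    (single (k := k) a n : M.Elem →₀ N) = Finsupp.single a (e k (supp a) (supp a) • n) := rfl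

theorem coe_single_of_eq {a : M.Elem} {n : N} (h : e k (supp a) (supp a) • n = n) :
    (single (k := k) a n : M.Elem →₀ N) = Finsupp.single a n := by
  rw [coe_single, h]

theorem t_smul_single {a b c : M.Elem} (h : IsSum b a c) (n : N) :
    t k b • single (k := k) a n = single c (e k (supp c) (supp a) • n) := by
  apply Subtype.ext
  rw [coe_smul_sections, actLin_t, coe_single, act_single h, coe_single, ← eMap_apply,
    eMap_eMap h.supp_right_le le_rfl, ← eMap_apply, ← eMap_apply, eMap_eMap le_rfl h.supp_right_le]

theorem t_smul_single_of_not {a b : M.Elem} (h : ¬ ∃ c, IsSum b a c) (n : N) :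
    t k b • single (k := k) a n = 0 := by
  apply Subtype.ext
  rw [coe_smul_sections, actLin_t, coe_single, act_single_of_not h]
  rfl

theorem single_apply_self (x : sections M k N) (a : M.Elem) :
    (single (k := k) a ((x : M.Elem →₀ N) a) : M.Elem →₀ N) = Finsupp.single a ((x : M.Elem →₀ N) a) :=
  coe_single_of_eq (x.2 a)

theorem eq_sum_single (x : sections M k N) :
    x = ∑ a ∈ (x : M.Elem →₀ N).support, single a ((x : M.Elem →₀ N) a) := by
  apply Subtype.ext
  rw [AddSubmonoidClass.coe_finsetSum]
  simp only [single_apply_self]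
  exact (Finsupp.sum_single (x : M.Elem →₀ N)).symm

variable (k N M)

/-- The sections of degree `c`. -/
def sectionsDeg (c : M.Deg) : Submodule k (sections M k N) where
  carrier := {x | ∀ a, M.toDeg a ≠ c → (x : M.Elem →₀ N) a = 0}
  add_mem' hx hy a ha := by
    rw [Submodule.coe_add, Finsupp.add_apply, hx a ha, hy a ha, add_zero]
  zero_mem' a _ := rfl
  smul_mem' r x hx a ha := by
    rw [Submodule.coe_smul, Finsupp.smul_apply, hx a ha, smul_zero]

variable {k N M}

theorem single_mem (a : M.Elem) (n : N) : single a n ∈ sectionsDeg M k N (M.toDeg a) := by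
  intro b hb
  rw [coe_single, Finsupp.single_eq_of_ne]
  rintro rfl
  exact hb rfl

/-- Only one element of `|M|` has a given degree, because `toDeg` is injective. -/
theorem eq_single {a : M.Elem} {x : sections M k N} (hx : x ∈ sectionsDeg M k N (M.toDeg a)) :
    x = single a ((x : M.Elem →₀ N) a) := by
  apply Subtype.ext
  rw [single_apply_self]
  ext b
  by_cases h : b = a
  · subst h
    rw [Finsupp.single_eq_same]
  · rw [Finsupp.single_eq_of_ne h]
    exact hx b fun h' => h (toDeg_injective h')

theorem eq_zero_of_mem_sectionsDeg {c : M.Deg} (hc : c ∉ Set.range M.toDeg) {x : sections M k N}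
    (hx : x ∈ sectionsDeg M k N c) : x = 0 :=
  Subtype.ext (Finsupp.ext fun a => hx a fun h => hc ⟨a, h⟩)

open Classical in
theorem sectionsDeg_isInternal : DirectSum.IsInternal (sectionsDeg M k N) := by
  apply DirectSum.isInternal_submodule_of_iSupIndep_of_iSup_eq_top
  · rw [iSupIndep_def]
    intro c
    rw [Submodule.disjoint_def]
    intro x hx hx'
    refine Subtype.ext (Finsupp.ext fun a => ?_)
    by_cases ha : M.toDeg a = c
    · have hle : (⨆ j, ⨆ (_ : j ≠ c), sectionsDeg M k N j) ≤
          LinearMap.ker ((Finsupp.lapply a).comp (sections M k N).subtype) :=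
        iSup_le fun j => iSup_le fun hj y hy => hy a fun h => hj (h.symm.trans ha)
      exact hle hx'
    · exact hx a ha
  · rw [eq_top_iff]
    rintro x -
    rw [eq_sum_single x]
    exact sum_mem fun a _ => Submodule.mem_iSup_of_mem _ (single_mem a _)

variable (k N M)

/-- The `ℤM`-graded module of sections. -/
noncomputable def gradedSections : ZGradedModule k M where
  carrier := sections M k N
  addCommGroup := inferInstance
  moduleField := inferInstance
  module := inferInstance
  isScalarTower := inferInstance
  deg := sectionsDeg M k N
  isInternal := sectionsDeg_isInternal
  smul_mem a b c h x hx := by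
    by_cases hb : b ∈ Set.range M.toDeg
    · obtain ⟨b, rfl⟩ := hb
      obtain ⟨d, hd, rfl⟩ := h.exists_isSum
      rw [eq_single hx, t_smul_single hd]
      exact single_mem d _
    · rw [eq_zero_of_mem_sectionsDeg hb hx, smul_zero]
      exact zero_mem _
  smul_eq_zero a b h x hx := by
    by_cases hb : b ∈ Set.range M.toDeg
    · obtain ⟨b, rfl⟩ := hb
      rw [eq_single hx, t_smul_single_of_not]
      rintro ⟨c, σ, y, z, hy, rfl, -⟩
      exact h ⟨σ, ⟨y, hy⟩, ⟨M.toGroup z, rfl⟩⟩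
    · rw [eq_zero_of_mem_sectionsDeg hb hx, smul_zero]

/-- Between two degrees of the same support `σ`, a monomial acts as the identity of `e_{σ,σ} N`.
This gives the bijectivity condition, and with `exists_finset_isSum` also finite generation: values
spanning `N`, placed at finitely many degrees, generate. -/
theorem isSquarefree_gradedSections [Module.Finite k N] :
    ZGradedModule.isSquarefree k M (gradedSections M k N) := by
  classical
  refine ⟨?_, fun c hc => ?_, fun a b c σ h ha hc => ?_⟩
  · obtain ⟨T, hT⟩ := (inferInstance : Module.Finite k N).fg_top
    obtain ⟨G, hG⟩ := exists_finset_isSum M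
    change Module.Finite (ToricFaceRing k M) (sections M k N)
    refine ⟨⟨G.biUnion fun g => T.image (single g), ?_⟩⟩
    rw [eq_top_iff]
    rintro x -
    set W := Submodule.span (ToricFaceRing k M)
      ((G.biUnion fun g => T.image (single g) : Finset (sections M k N)) :
        Set (sections M k N)) with hW
    have hg : ∀ g ∈ G, ∀ n : N, single g n ∈ W := by
      intro g hg n
      have hn : n ∈ Submodule.span k (T : Set N) := by rw [hT]; trivial
      have hle : Submodule.span k (T : Set N) ≤ (W.restrictScalars k).comap (single g) := by
        refine Submodule.span_le.2 fun n hn => Submodule.subset_span ?_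
        exact Finset.mem_biUnion.2 ⟨g, hg, Finset.mem_image_of_mem _ hn⟩
      exact hle hn
    rw [eq_sum_single x]
    refine sum_mem fun a _ => ?_
    obtain ⟨g, hgG, hsupp, b, hb⟩ := hG a
    have h := t_smul_single (k := k) hb ((x : M.Elem →₀ N) a)
    -- As `g` and `a` have the same support, the factor is an idempotent that fixes the value of the
    -- section.
    rw [hsupp, x.2 a] at h
    rw [← h]
    exact Submodule.smul_mem _ _ (hg g hgG _)
  · rw [Submodule.eq_bot_iff]
    exact fun x hx => eq_zero_of_mem_sectionsDeg hc hx
  · change Set.BijOn (fun x : sections M k N => t k b • x)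
      (sectionsDeg M k N (M.toDeg a)) (sectionsDeg M k N (M.toDeg c))
    have hs : supp c = supp a := hc.supp_eq.trans ha.supp_eq.symm
    have key : ∀ x ∈ sectionsDeg M k N (M.toDeg a),
        t k b • x = single c ((x : M.Elem →₀ N) a) := by
      intro x hx
      conv_lhs => rw [eq_single hx]
      rw [t_smul_single h.symm, hs, x.2 a]
    refine ⟨fun x hx => ?_, fun x hx y hy hxy => ?_, fun x hx => ?_⟩
    · change t k b • x ∈ _
      rw [key x hx]
      exact single_mem c _
    · change t k b • x = t k b • y at hxy
      rw [key x hx, key y hy] at hxy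
      have h' := congrArg (fun z : sections M k N => (z : M.Elem →₀ N) c) hxy
      simp only [coe_single, Finsupp.single_eq_same] at h'
      rw [hs, x.2 a, y.2 a] at h'
      rw [eq_single hx, eq_single hy, h']
    · refine ⟨single a ((x : M.Elem →₀ N) c), single_mem a _, ?_⟩
      change t k b • single a ((x : M.Elem →₀ N) c) = x
      rw [t_smul_single h.symm, hs, ← hs, x.2 c]
      exact (eq_single hx).symm

end Action

end CellIncidenceAlgebra

/-! ### The functor from `Λ`-modules to squarefree modules is fully faithful -/

namespace CellIncidenceAlgebra

variable {X : Type v} [TopologicalSpace X] {K : RegularCellComplex X} {C : ConicalComplex K}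
  {M : MonoidalComplex C} {k : Type u} [Field k]

open MonoidalComplex ToricFaceRing SquarefreeModuleCat

section Functor

variable {N : Type (max u v)} [AddCommGroup N] [Module (CellIncidenceAlgebra K k) N]

theorem e_smul_of_not {σ τ : K.Cell} (h : ¬ τ ≤ σ) (n : N) : e k σ τ • n = 0 := by
  rw [e_of_not h]
  exact zero_smul (CellIncidenceAlgebra K k) n

theorem e_smul_e_smul_of_ne {σ τ τ' υ : K.Cell} (h : τ ≠ τ') (n : N) :
    e k σ τ • e k τ' υ • n = 0 := by
  rw [smul_smul, e_mul_e_of_ne h]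
  exact zero_smul (CellIncidenceAlgebra K k) n

variable [Module k N] [IsScalarTower k (CellIncidenceAlgebra K k) N]
  {N' : Type (max u v)} [AddCommGroup N'] [Module k N']
  [Module (CellIncidenceAlgebra K k) N'] [IsScalarTower k (CellIncidenceAlgebra K k) N']

theorem actLin_mapRange (g : N →ₗ[CellIncidenceAlgebra K k] N') (f : ToricFaceRing k M)
    (x : M.Elem →₀ N) :
    actLin M k N' f (Finsupp.mapRange.linearMap (g.restrictScalars k) x) =
      Finsupp.mapRange.linearMap (g.restrictScalars k) (actLin M k N f x) := by
  induction f using induction_t k with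
  | h0 => simp only [map_zero, LinearMap.zero_apply]
  | hadd f₁ f₂ h₁ h₂ => simp only [map_add, LinearMap.add_apply, h₁, h₂]
  | ht r b =>
    simp only [map_smul, LinearMap.smul_apply, actLin_t]
    congr 1
    induction x using Finsupp.induction_linear with
    | zero => simp only [map_zero]
    | add x y hx hy => simp only [map_add, hx, hy]
    | single a n =>
      rw [Finsupp.mapRange.linearMap_apply, Finsupp.mapRange_single]
      by_cases h : ∃ c, IsSum b a c
      · obtain ⟨c, h⟩ := h
        rw [act_single h, act_single h, Finsupp.mapRange.linearMap_apply, Finsupp.mapRange_single]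
        congr 1
        exact (g.map_smul _ n).symm
      · rw [act_single_of_not h, act_single_of_not h, map_zero]

variable (M) in
/-- The map on sections induced by a homomorphism. -/
noncomputable def mapSections (g : N →ₗ[CellIncidenceAlgebra K k] N') :
    sections M k N →ₗ[ToricFaceRing k M] sections M k N' where
  toFun x := ⟨Finsupp.mapRange.linearMap (g.restrictScalars k) x.1, mem_sections_iff.2 (by
    rw [actLin_mapRange, mem_sections_iff.1 x.2])⟩
  map_add' x y := Subtype.ext (map_add _ _ _)
  map_smul' f x := Subtype.ext (actLin_mapRange g f x.1).symm

variable (M k N) in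
/-- The squarefree module of sections. -/
noncomputable def squarefreeSections [Module.Finite k N] : SquarefreeModuleCat k M :=
  ⟨gradedSections M k N, isSquarefree_gradedSections M k N⟩

variable [Module.Finite k N] [Module.Finite k N']

/-- The value of a homogeneous section at its degree. -/
noncomputable def eval (a : M.Elem) : comp (squarefreeSections M k N) a →ₗ[k] N :=
  (Finsupp.lapply a).comp ((sections M k N).subtype.comp
    (comp (squarefreeSections M k N) a).subtype)

theorem eval_injective (a : M.Elem) : Function.Injective (eval (k := k) (N := N) a) := by
  intro x y h
  apply Subtype.ext
  rw [eq_single x.2, eq_single y.2]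
  exact congrArg (single a) h

theorem e_smul_eval {a : M.Elem} (x : comp (squarefreeSections M k N) a) :
    e k (supp a) (supp a) • eval a x = eval a x :=
  x.1.2 a

/-- The homogeneous section of degree `a` with value `e_{σ,σ} n`, where `σ = supp a`. -/
noncomputable def homSingle (a : M.Elem) : N →ₗ[k] comp (squarefreeSections M k N) a :=
  (single a).codRestrict _ fun n => single_mem a n

theorem eval_homSingle (a : M.Elem) (n : N) :
    eval a (homSingle (k := k) a n) = e k (supp a) (supp a) • n := by
  change (single (k := k) a n : M.Elem →₀ N) a = _
  rw [coe_single, Finsupp.single_eq_same]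

theorem homSingle_eval {a : M.Elem} (x : comp (squarefreeSections M k N) a) :
    homSingle a (eval a x) = x := by
  apply eval_injective
  rw [eval_homSingle, e_smul_eval]

theorem eval_t_smul {a b c : M.Elem} (h : IsSum b a c) (x : comp (squarefreeSections M k N) a) :
    eval c ⟨t k b • (x : (squarefreeSections M k N).obj.carrier), t_smul_mem h x.2⟩ =
      e k (supp c) (supp a) • eval a x := by
  have hx : (x : (squarefreeSections M k N).obj.carrier) = single a (eval a x) := eq_single x.2
  have h1 : t k b • (x : (squarefreeSections M k N).obj.carrier) =
      single c (e k (supp c) (supp a) • eval a x) := by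
    rw [hx]
    exact t_smul_single h _
  have h2 : (⟨t k b • (x : (squarefreeSections M k N).obj.carrier), t_smul_mem h x.2⟩ :
      comp (squarefreeSections M k N) c) = homSingle c (e k (supp c) (supp a) • eval a x) :=
    Subtype.ext h1
  rw [h2, eval_homSingle, smul_smul, e_mul_e le_rfl h.supp_right_le]

/-- The dictionary between the two sides: evaluation identifies the component of degree `a` with
`e_{σ,σ} N`, `σ = supp a`, and transport becomes multiplication by a basis element of `Λ`. -/
theorem eval_transport (a b : M.Elem) (x : comp (squarefreeSections M k N) a) :
    eval b (transport _ a b x) = e k (supp b) (supp a) • eval a x := by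
  by_cases h : supp a ≤ supp b
  · have hz : homSingle b (e k (supp b) (supp a) • eval a x) = transport _ a b x := by
      refine eq_transport h ?_
      -- With `c = a + b` one has `supp c = supp b`, and both products evaluate to `e_{σ,τ}` times
      -- the value of `x`, where `σ = supp b` and `τ = supp a`.
      obtain ⟨c, hc⟩ := exists_isSum h le_rfl
      have hs := hc.symm.supp_eq_left h
      have : (⟨_, t_smul_mem hc (homSingle b (e k (supp b) (supp a) • eval a x)).2⟩ :
          comp (squarefreeSections M k N) c) = ⟨_, t_smul_mem hc.symm x.2⟩ := by
        apply eval_injective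
        rw [eval_t_smul hc, eval_t_smul hc.symm, eval_homSingle, smul_smul, smul_smul, hs,
          e_mul_e le_rfl le_rfl, e_mul_e le_rfl h]
      exact congrArg Subtype.val this
    rw [← hz, eval_homSingle, smul_smul, e_mul_e le_rfl h]
  · rw [transport_of_not h, e_smul_of_not h, LinearMap.zero_apply, map_zero]

variable (M) in
/-- The morphism of squarefree modules induced by a homomorphism. -/
noncomputable def mapSquarefree (g : N →ₗ[CellIncidenceAlgebra K k] N') :
    squarefreeSections M k N ⟶ squarefreeSections M k N' :=
  ⟨{ toLinearMap := mapSections M g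
     map_deg := fun c x hx a ha => by
      exact (congrArg g (hx a ha)).trans (map_zero g) }⟩

theorem eval_appComp_mapSquarefree (g : N →ₗ[CellIncidenceAlgebra K k] N') {a : M.Elem}
    (x : comp (squarefreeSections M k N) a) :
    eval a (appComp (mapSquarefree M g) a x) = g (eval a x) := rfl

/-- The linear map that recovers a homomorphism from the induced morphism. -/
noncomputable def preimageLin (F : squarefreeSections M k N ⟶ squarefreeSections M k N') :
    N →ₗ[k] N' :=
  ∑ σ : K.Cell, (eval (M.interiorElem σ)).comp
    ((appComp F (M.interiorElem σ)).comp (homSingle (M.interiorElem σ)))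

theorem preimageLin_apply (F : squarefreeSections M k N ⟶ squarefreeSections M k N') (n : N) :
    preimageLin F n = ∑ σ : K.Cell, eval (M.interiorElem σ)
      (appComp F (M.interiorElem σ) (homSingle (M.interiorElem σ) n)) := by
  rw [preimageLin, LinearMap.sum_apply]
  rfl

theorem homSingle_e_smul_of_ne {ρ σ τ : K.Cell} (h : ρ ≠ σ) (n : N) :
    homSingle (k := k) (M.interiorElem ρ) (e k σ τ • n) = 0 := by
  apply eval_injective
  rw [eval_homSingle, supp_interiorElem, e_smul_e_smul_of_ne h, map_zero]

theorem homSingle_e_smul {σ τ : K.Cell} (n : N) :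
    homSingle (k := k) (M.interiorElem σ) (e k σ τ • n) =
      transport _ (M.interiorElem τ) (M.interiorElem σ) (homSingle (M.interiorElem τ) n) := by
  apply eval_injective
  rw [eval_homSingle, eval_transport, eval_homSingle, supp_interiorElem, supp_interiorElem]
  by_cases h : τ ≤ σ
  · rw [smul_smul, smul_smul, e_mul_e le_rfl h, e_mul_e h le_rfl]
  · rw [e_smul_of_not h, e_smul_of_not h, smul_zero]

/-- By orthogonality of the idempotents one summand survives on each side, at `σ` and at `τ`. They
agree by naturality of transport. -/
theorem preimageLin_e_smul (F : squarefreeSections M k N ⟶ squarefreeSections M k N')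
    (σ τ : K.Cell) (n : N) : preimageLin F (e k σ τ • n) = e k σ τ • preimageLin F n := by
  rw [preimageLin_apply, preimageLin_apply, Finset.sum_eq_single σ, Finset.smul_sum,
    Finset.sum_eq_single τ]
  · rw [homSingle_e_smul, appComp_transport, eval_transport, supp_interiorElem, supp_interiorElem]
  · intro ρ _ hρ
    rw [← e_smul_eval, supp_interiorElem, e_smul_e_smul_of_ne hρ.symm]
  · intro h
    exact absurd (Finset.mem_univ _) h
  · intro ρ _ hρ
    rw [homSingle_e_smul_of_ne hρ, map_zero, map_zero]
  · intro h
    exact absurd (Finset.mem_univ _) h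

/-- The homomorphism inducing a given morphism. -/
noncomputable def preimage (F : squarefreeSections M k N ⟶ squarefreeSections M k N') :
    N →ₗ[CellIncidenceAlgebra K k] N' where
  toFun := preimageLin F
  map_add' := map_add _
  map_smul' f n := by
    rw [eq_sum_e f]
    simp only [Finset.sum_smul, map_sum, smul_assoc, map_smul, preimageLin_e_smul,
      RingHom.id_apply]

theorem preimage_eval (F : squarefreeSections M k N ⟶ squarefreeSections M k N') (σ : K.Cell)
    (x : comp (squarefreeSections M k N) (M.interiorElem σ)) :
    preimage F (eval _ x) = eval _ (appComp F _ x) := by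
  change preimageLin F (eval _ x) = _
  rw [preimageLin_apply, Finset.sum_eq_single σ, homSingle_eval]
  · intro ρ _ hρ
    have hx := e_smul_eval x
    rw [supp_interiorElem] at hx
    rw [← hx, homSingle_e_smul_of_ne hρ, map_zero, map_zero]
  · intro h
    exact absurd (Finset.mem_univ _) h

theorem mapSquarefree_preimage (F : squarefreeSections M k N ⟶ squarefreeSections M k N') :
    mapSquarefree M (preimage F) = F := by
  refine hom_ext_interiorElem fun σ m hm => ?_
  have : appComp (mapSquarefree M (preimage F)) _ ⟨m, hm⟩ = appComp F _ ⟨m, hm⟩ := by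
    apply eval_injective
    rw [eval_appComp_mapSquarefree, preimage_eval]
  exact congrArg Subtype.val this

/-- Since the idempotents add up to `1`, every `n` is a sum of values of homogeneous sections. -/
theorem mapSquarefree_injective :
    Function.Injective (mapSquarefree M : (N →ₗ[CellIncidenceAlgebra K k] N') → _) := by
  intro g g' h
  ext n
  have hn : n = ∑ σ : K.Cell, eval (M.interiorElem σ) (homSingle (k := k) (M.interiorElem σ) n) := by
    simp only [eval_homSingle, supp_interiorElem, ← Finset.sum_smul, sum_e, one_smul]
  rw [hn, map_sum, map_sum]
  refine Finset.sum_congr rfl fun σ _ => ?_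
  rw [← eval_appComp_mapSquarefree, h, eval_appComp_mapSquarefree]

end Functor

open scoped ModuleCat

noncomputable instance (P : FGModuleCat.{max u v} (CellIncidenceAlgebra K k)) :
    Module.Finite k P :=
  Module.Finite.trans (CellIncidenceAlgebra K k) P

variable (M k) in
/-- The functor from finitely generated modules over the incidence algebra to squarefree
modules. -/
noncomputable def toSquarefree :
    FGModuleCat.{max u v} (CellIncidenceAlgebra K k) ⥤ SquarefreeModuleCat k M where
  obj P := squarefreeSections M k P
  map g := mapSquarefree M g.hom.hom
  map_id _ := app_injective (LinearMap.ext fun _ => Subtype.ext (Finsupp.ext fun _ => rfl))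
  map_comp _ _ := app_injective (LinearMap.ext fun _ => Subtype.ext (Finsupp.ext fun _ => rfl))

instance : (toSquarefree M k).Faithful where
  map_injective h := FGModuleCat.hom_ext (mapSquarefree_injective h)

instance : (toSquarefree M k).Full where
  map_surjective F := ⟨FGModuleCat.ofHom (preimage F), mapSquarefree_preimage F⟩

/-! ### Essential surjectivity: recovering a squarefree module from its stalks -/

section Stalks

/-- The product of the components of `N` in the degrees `interiorElem σ`. -/
def Stalks (N : SquarefreeModuleCat k M) : Type (max u v) :=
  ∀ σ : K.Cell, comp N (M.interiorElem σ)

variable {N : SquarefreeModuleCat k M}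

noncomputable instance : AddCommGroup (Stalks N) :=
  inferInstanceAs (AddCommGroup (∀ σ : K.Cell, comp N (M.interiorElem σ)))

theorem Stalks.ext {w w' : Stalks N} (h : ∀ σ, w σ = w' σ) : w = w' := funext h

theorem Stalks.add_apply (w w' : Stalks N) (σ : K.Cell) : (w + w') σ = w σ + w' σ := rfl

/-- The action for which `e_{σ,τ}` is transport from the stalk at `τ` to the stalk at `σ`. -/
noncomputable instance : SMul (CellIncidenceAlgebra K k) (Stalks N) :=
  ⟨fun f w σ => ∑ τ : K.Cell,
    coeff f σ τ • transport N (M.interiorElem τ) (M.interiorElem σ) (w τ)⟩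

theorem Stalks.smul_apply (f : CellIncidenceAlgebra K k) (w : Stalks N) (σ : K.Cell) :
    (f • w) σ = ∑ τ : K.Cell,
      coeff f σ τ • transport N (M.interiorElem τ) (M.interiorElem σ) (w τ) := rfl

noncomputable instance : Module (CellIncidenceAlgebra K k) (Stalks N) where
  one_smul w := Stalks.ext fun σ => by
    rw [Stalks.smul_apply, Finset.sum_eq_single σ]
    · rw [coeff_one, if_pos rfl, one_smul, transport_self]
    · intro τ _ hτ
      rw [coeff_one, if_neg hτ.symm, zero_smul]
    · intro h
      exact absurd (Finset.mem_univ _) h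
  mul_smul f g w := Stalks.ext fun σ => by
    simp only [Stalks.smul_apply, coeff_mul, Finset.sum_smul, map_sum, map_smul, Finset.smul_sum]
    rw [Finset.sum_comm]
    refine Finset.sum_congr rfl fun τ _ => Finset.sum_congr rfl fun υ _ => ?_
    -- Transports compose along `υ ≤ τ ≤ σ`; for other triples one of the coefficients vanishes.
    by_cases h : τ ≤ σ
    · by_cases h' : υ ≤ τ
      · rw [transport_transport (by simpa) (by simpa), mul_smul]
      · rw [coeff_of_not h', mul_zero, zero_smul, zero_smul, smul_zero]
    · rw [coeff_of_not h, zero_mul, zero_smul, zero_smul]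
  smul_zero f := Stalks.ext fun σ => by
    rw [Stalks.smul_apply]
    exact Finset.sum_eq_zero fun τ _ => by
      change _ • transport N _ _ 0 = _
      rw [map_zero, smul_zero]
  smul_add f w w' := Stalks.ext fun σ => by
    simp only [Stalks.smul_apply, Stalks.add_apply, map_add, smul_add, Finset.sum_add_distrib]
  add_smul f g w := Stalks.ext fun σ => by
    simp only [Stalks.smul_apply, Stalks.add_apply, coeff_add, add_smul, Finset.sum_add_distrib]
  zero_smul w := Stalks.ext fun σ => by
    rw [Stalks.smul_apply]
    exact Finset.sum_eq_zero fun τ _ => by rw [coeff_zero, zero_smul]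

noncomputable instance : Module k (Stalks N) :=
  Module.restrictScalars k (CellIncidenceAlgebra K k) (Stalks N)

instance : IsScalarTower k (CellIncidenceAlgebra K k) (Stalks N) :=
  IsScalarTower.restrictScalars k (CellIncidenceAlgebra K k) (Stalks N)

/-- The scalars of `k` are defined by restriction from `Λ`, which makes the tower condition
automatic; they agree with the componentwise ones. -/
theorem Stalks.field_smul_apply (r : k) (w : Stalks N) (σ : K.Cell) : (r • w) σ = r • w σ := by
  rw [← one_smul (CellIncidenceAlgebra K k) w, ← smul_assoc, Stalks.smul_apply, Stalks.smul_apply,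
    Finset.smul_sum]
  simp only [coeff_smul, mul_smul]

open Classical in
-- The transport is written with target `ρ` and not `σ`, so that no cast along `ρ = σ` is needed.
theorem Stalks.e_smul_apply (σ τ ρ : K.Cell) (w : Stalks N) :
    (e k σ τ • w) ρ = if _ : ρ = σ then transport N (M.interiorElem τ) (M.interiorElem ρ) (w τ)
      else 0 := by
  rw [Stalks.smul_apply]
  by_cases h : ρ = σ
  · subst h
    rw [dif_pos rfl, Finset.sum_eq_single τ]
    · by_cases h : τ ≤ ρ
      · simp [coeff_e, h]
      · rw [transport_of_not (by simpa using h), LinearMap.zero_apply, smul_zero]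
    · intro υ _ hυ
      simp [coeff_e, hυ]
    · intro h
      exact absurd (Finset.mem_univ _) h
  · rw [dif_neg h]
    exact Finset.sum_eq_zero fun υ _ => by simp [coeff_e, h]

/-- The projection to a component. -/
noncomputable def Stalks.proj (N : SquarefreeModuleCat k M) (σ : K.Cell) :
    Stalks N →ₗ[k] comp N (M.interiorElem σ) where
  toFun w := w σ
  map_add' _ _ := rfl
  map_smul' r w := Stalks.field_smul_apply r w σ

instance : Module.Finite k (Stalks N) := by
  let φ : Stalks N →ₗ[k] (∀ σ : K.Cell, comp N (M.interiorElem σ)) :=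
    LinearMap.pi (Stalks.proj N)
  exact Module.Finite.of_injective φ fun w w' h => h

instance : Module.Finite (CellIncidenceAlgebra K k) (Stalks N) :=
  Module.Finite.of_restrictScalars_finite k _ _

/-- The comparison of the sections of `Stalks N` with `N`, in degree `a`. -/
noncomputable def stalkMap (N : SquarefreeModuleCat k M) (a : M.Elem) :
    comp (squarefreeSections M k (Stalks N)) a →ₗ[k] comp N a :=
  (transport N (M.interiorElem (supp a)) a).comp ((Stalks.proj N (supp a)).comp (eval a))

theorem stalkMap_apply {a : M.Elem} (x : comp (squarefreeSections M k (Stalks N)) a) :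
    stalkMap N a x = transport N (M.interiorElem (supp a)) a (eval a x (supp a)) := rfl

/-- The values of sections of degree `a` form `e_{σ,σ}` of the product, `σ = supp a`. This is the
factor at `σ`, and transport between degrees of equal support is bijective. -/
theorem stalkMap_bijective (a : M.Elem) : Function.Bijective (stalkMap N a) := by
  classical
  constructor
  · rw [injective_iff_map_eq_zero]
    intro x hx
    apply eval_injective
    rw [map_zero]
    have h0 : eval a x (supp a) = 0 :=
      (map_eq_zero_iff _ (transportEquiv N (supp_interiorElem (supp a))).injective).1 hx
    rw [← e_smul_eval]
    refine Stalks.ext fun ρ => ?_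
    rw [Stalks.e_smul_apply, h0, map_zero]
    exact dite_eq_right_iff.2 fun _ => rfl
  · intro m
    let w : Stalks N := Pi.single (supp a) (transport N a (M.interiorElem (supp a)) m)
    refine ⟨homSingle a w, ?_⟩
    have hw : w (supp a) = transport N a (M.interiorElem (supp a)) m := Pi.single_eq_same _ _
    rw [stalkMap_apply, eval_homSingle, Stalks.e_smul_apply, dif_pos rfl, hw, transport_self,
      transport_transport (by simp) (by simp), transport_self]

/-- A squarefree module is recovered from its components in the degrees `interiorElem σ`. -/
noncomputable def stalksIso (N : SquarefreeModuleCat k M) :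
    squarefreeSections M k (Stalks N) ≅ N :=
  isoOfComponents (fun a => LinearEquiv.ofBijective (stalkMap N a) (stalkMap_bijective a)) (by
    intro a b c h x
    -- By functoriality both sides are the transport from `interiorElem (supp a)` to `c`.
    have h1 : stalkMap N c ⟨t k b • (x : (squarefreeSections M k (Stalks N)).obj.carrier),
        t_smul_mem h x.2⟩ = transport N a c (stalkMap N a x) := by
      rw [stalkMap_apply, eval_t_smul h, Stalks.e_smul_apply, dif_pos rfl, stalkMap_apply,
        transport_transport (by simpa using h.supp_right_le) (by simp),
        transport_transport (by simp) h.supp_right_le]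
    rw [transport_isSum h] at h1
    exact congrArg Subtype.val h1)

instance : (toSquarefree M k).EssSurj where
  mem_essImage N := ⟨FGModuleCat.of (CellIncidenceAlgebra K k) (Stalks N), ⟨stalksIso N⟩⟩

instance : (toSquarefree M k).IsEquivalence where

end Stalks

end CellIncidenceAlgebra

/-! ### The abelian structure and monomorphisms -/

namespace SquarefreeModuleCat

open MonoidalComplex ToricFaceRing CellIncidenceAlgebra Limits

variable {X : Type v} [TopologicalSpace X] {K : RegularCellComplex X} {C : ConicalComplex K}
  {M : MonoidalComplex C} {k : Type u} [Field k]

instance : HasFiniteProducts (SquarefreeModuleCat k M) :=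
  ⟨fun _ => Adjunction.hasLimitsOfShape_of_equivalence (toSquarefree M k).inv⟩

instance : HasFiniteBiproducts (SquarefreeModuleCat k M) :=
  HasFiniteBiproducts.of_hasFiniteProducts

instance : HasBinaryBiproducts (SquarefreeModuleCat k M) :=
  hasBinaryBiproducts_of_finite_biproducts _

/-- The abelian structure is transferred along the equivalence on top of the pointwise addition, so
the comparison of preadditive structures is definitional. -/
theorem exists_abelian : ∃ A : Abelian (SquarefreeModuleCat k M),
    A.toPreadditive = SquarefreeModuleCat.preadditive k M :=
  ⟨abelianOfEquivalence (toSquarefree M k).inv, rfl⟩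

instance : HasCokernels (SquarefreeModuleCat k M) := by
  let A : Abelian (SquarefreeModuleCat k M) := abelianOfEquivalence (toSquarefree M k).inv
  exact A.has_cokernels

open scoped ModuleCat in
-- Monomorphisms are transferred to `Λ`-modules, where they are injective; the functor of sections
-- applies the injective map to values.
theorem app_injective_of_mono {A B : SquarefreeModuleCat k M} (f : A ⟶ B) [Mono f] :
    Function.Injective (app f) := by
  let F := toSquarefree M k
  let i := F.objObjPreimageIso A
  let j := F.objObjPreimageIso B
  obtain ⟨g, hg⟩ := F.map_surjective (i.hom ≫ f ≫ j.inv)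
  have : Mono (F.map g) := by rw [hg]; infer_instance
  have hgm : Mono g := F.mono_of_mono_map this
  -- The forgetful functor to all `Λ`-modules preserves monomorphisms.
  have hinj : Function.Injective g.hom.hom :=
    (ModuleCat.mono_iff_injective ((forget₂ (FGModuleCat.{max u v} (CellIncidenceAlgebra K k))
      (ModuleCat.{max u v} (CellIncidenceAlgebra K k))).map g)).1 inferInstance
  have hF : Function.Injective (app (F.map g)) := by
    intro x y hxy
    refine Subtype.ext (Finsupp.ext fun a => hinj ?_)
    exact congrArg (fun z : sections M k (F.objPreimage B) => z.1 a) hxy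
  have hi : Function.Injective (app i.inv) :=
    Function.LeftInverse.injective (g := app i.hom) fun x => by
      rw [← app_comp, i.inv_hom_id, app_id]
  have hj : Function.Injective (app j.hom) :=
    Function.LeftInverse.injective (g := app j.inv) fun x => by
      rw [← app_comp, j.hom_inv_id, app_id]
  have hf : f = i.inv ≫ F.map g ≫ j.hom := by
    rw [hg]; simp
  intro x y hxy
  rw [hf] at hxy
  exact hi (hF (hj hxy))

/-! ### The modules `R/𝔭_σ` are indecomposable injectives -/

section QuotPrime

variable {σ : K.Cell} {N : SquarefreeModuleCat k M}

/-- The class of `t^a` in `R/𝔭_σ`. -/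
noncomputable def mono (k : Type u) [Field k] (σ : K.Cell) (a : M.Elem) :
    comp (quotPrime k M σ) a :=
  ⟨tQuot k σ a, tQuot_mem_quotDeg k σ a⟩

theorem mono_of_not {a : M.Elem} (h : ¬ supp a ≤ σ) : mono k σ a = 0 :=
  Subtype.ext (tQuot_of_not k fun h' => h (memCell_iff.1 h'))

theorem mono_ne_zero {a : M.Elem} (h : supp a ≤ σ) : mono k σ a ≠ 0 := by
  intro h0
  have h1 : tQuot k σ a = 0 := congrArg Subtype.val h0
  have h2 := restrictQuot_tQuot k (memCell_iff.2 h)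
  rw [h1, map_zero, ← basis_apply] at h2
  exact (basis k).ne_zero a h2.symm

theorem exists_eq_smul_mono {a : M.Elem} (m : comp (quotPrime k M σ) a) :
    ∃ r : k, m = r • mono k σ a := by
  obtain ⟨r, hr⟩ := Submodule.mem_span_singleton.1 ((quotDeg_toDeg k σ a).le m.2)
  exact ⟨r, Subtype.ext hr.symm⟩

theorem eq_zero_of_not_supp_le {a : M.Elem} (h : ¬ supp a ≤ σ) (m : comp (quotPrime k M σ) a) :
    m = 0 := by
  obtain ⟨r, rfl⟩ := exists_eq_smul_mono m
  rw [mono_of_not h, smul_zero]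

theorem t_smul_mono {a b c : M.Elem} (h : IsSum b a c) :
    t k b • (mono k σ a : (quotPrime k M σ).obj.carrier) = (mono k σ c).1 :=
  t_smul_tQuot k h

/-- In the basis of monomial classes, `R/𝔭_σ` is the constant representation `k` on the cells below
`σ`; both sides are compared after multiplication by `t^a`. -/
theorem transport_mono {a b : M.Elem} (h : supp a ≤ supp b) :
    transport (quotPrime k M σ) a b (mono k σ a) = mono k σ b := by
  refine (eq_transport h ?_).symm
  obtain ⟨c, hc⟩ := exists_isSum h le_rfl
  rw [t_smul_mono hc, t_smul_mono hc.symm]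

/-- The coordinate of an element of `R/𝔭_σ` of degree `a` with support at most `σ`. -/
noncomputable def coord (k : Type u) [Field k] (σ : K.Cell) {a : M.Elem} (ha : supp a ≤ σ) :
    comp (quotPrime k M σ) a ≃ₗ[k] k :=
  (LinearEquiv.ofBijective (LinearMap.toSpanSingleton k _ (mono k σ a))
    ⟨by
      rw [injective_iff_map_eq_zero]
      intro r hr
      exact (smul_eq_zero.1 hr).resolve_right (mono_ne_zero ha), fun m => by
      obtain ⟨r, rfl⟩ := exists_eq_smul_mono m
      exact ⟨r, rfl⟩⟩).symm

theorem coord_smul_mono {a : M.Elem} (ha : supp a ≤ σ) (m : comp (quotPrime k M σ) a) :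
    coord k σ ha m • mono k σ a = m :=
  (coord k σ ha).symm_apply_apply m

/-- The morphism to `R/𝔭_σ` given by a linear functional on the component of degree
`interiorElem σ`. -/
noncomputable def toQuotPrime (φ : comp N (M.interiorElem σ) →ₗ[k] k) : N ⟶ quotPrime k M σ :=
  ofComponents (fun a => (LinearMap.toSpanSingleton k _ (mono k σ a)).comp
    (φ.comp (transport N a (M.interiorElem σ)))) (by
    intro a b c h m
    simp only [LinearMap.comp_apply, LinearMap.toSpanSingleton_apply, Submodule.coe_smul]
    rw [smul_comm, t_smul_mono h]
    -- Below `σ` the functional is compatible by functoriality of transport; elsewhere the target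
    -- component is zero.
    by_cases hc : supp c ≤ σ
    · rw [← transport_isSum h, transport_transport h.supp_right_le (by simpa using hc)]
    · rw [mono_of_not hc, Submodule.coe_zero, smul_zero, smul_zero])

theorem appComp_toQuotPrime (φ : comp N (M.interiorElem σ) →ₗ[k] k) {a : M.Elem} (m : comp N a) :
    appComp (toQuotPrime φ) a m = φ (transport N a (M.interiorElem σ) m) • mono k σ a :=
  Subtype.ext (lift_apply _ m)

theorem appComp_toQuotPrime_self (φ : comp N (M.interiorElem σ) →ₗ[k] k)
    (m : comp N (M.interiorElem σ)) :
    appComp (toQuotPrime φ) _ m = φ m • mono k σ (M.interiorElem σ) := by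
  rw [appComp_toQuotPrime, transport_self]

/-- On `R/𝔭_σ` transport to the stalk at `σ` is injective in degrees with support below `σ`, and the
other components vanish. With `toQuotPrime`, morphisms to `R/𝔭_σ` are thus the functionals on the
stalk at `σ`. -/
theorem quotPrime_hom_ext {f g : N ⟶ quotPrime k M σ}
    (h : ∀ m, appComp f (M.interiorElem σ) m = appComp g (M.interiorElem σ) m) : f = g := by
  refine hom_ext_comp fun a m hm => ?_
  suffices e : appComp f a ⟨m, hm⟩ = appComp g a ⟨m, hm⟩ from congrArg Subtype.val e
  by_cases ha : supp a ≤ σ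
  · have h' := h (transport N a _ ⟨m, hm⟩)
    rw [appComp_transport, appComp_transport] at h'
    obtain ⟨r, hr⟩ := exists_eq_smul_mono (appComp f a ⟨m, hm⟩)
    obtain ⟨s, hs⟩ := exists_eq_smul_mono (appComp g a ⟨m, hm⟩)
    rw [hr, hs, map_smul, map_smul, transport_mono (by simpa using ha)] at h'
    rw [hr, hs, smul_left_injective k (mono_ne_zero (by simp)) h']
  · rw [eq_zero_of_not_supp_le ha (appComp f a _), eq_zero_of_not_supp_le ha (appComp g a _)]

instance injective_quotPrime (σ : K.Cell) : Injective (quotPrime k M σ) where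
  factors {A B} g f _ := by
    have hs : supp (M.interiorElem σ) ≤ σ := by simp
    have hinj : LinearMap.ker (appComp f (M.interiorElem σ)) = ⊥ := by
      rw [LinearMap.ker_eq_bot]
      intro x y hxy
      exact Subtype.ext (app_injective_of_mono f (congrArg Subtype.val hxy))
    -- Extending a morphism along `f` means extending a functional along the injection of stalks at
    -- `σ`, for which a linear left inverse suffices.
    obtain ⟨l, hl⟩ := LinearMap.exists_leftInverse_of_injective _ hinj
    refine ⟨toQuotPrime (((coord k σ hs).toLinearMap.comp (appComp g _)).comp l),
      quotPrime_hom_ext fun m => ?_⟩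
    have h1 : ∀ φ : comp B (M.interiorElem σ) →ₗ[k] k, appComp (f ≫ toQuotPrime φ) (M.interiorElem σ) m =
      appComp (toQuotPrime φ) _ (appComp f _ m) := fun _ => rfl
    rw [h1, appComp_toQuotPrime_self, LinearMap.comp_apply, ← LinearMap.comp_apply l, hl]
    exact coord_smul_mono hs _

theorem not_isZero_quotPrime (σ : K.Cell) : ¬ IsZero (quotPrime k M σ) := by
  intro h
  refine mono_ne_zero (k := k) (σ := σ) (a := M.interiorElem σ) (by simp) (Subtype.ext ?_)
  have := congrArg (fun f => app f (mono k σ (M.interiorElem σ)).1) ((IsZero.iff_id_eq_zero _).1 h)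
  exact this

/-- Endomorphisms of `R/𝔭_σ` are scalars. -/
theorem exists_scalar (f : quotPrime k M σ ⟶ quotPrime k M σ) :
    ∃ r : k, ∀ m, appComp f (M.interiorElem σ) m = r • m := by
  obtain ⟨r, hr⟩ := exists_eq_smul_mono (appComp f _ (mono k σ (M.interiorElem σ)))
  refine ⟨r, fun m => ?_⟩
  obtain ⟨s, rfl⟩ := exists_eq_smul_mono m
  rw [map_smul, hr, smul_comm]

/-- The projections to the two summands, as endomorphisms, are scalars `r` and `s` with product
zero. One of them vanishes, and the identity of its summand factors through it. -/
theorem indecomposable_quotPrime (σ : K.Cell) : Indecomposable (quotPrime k M σ) := by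
  refine ⟨not_isZero_quotPrime σ, fun Y Z i => ?_⟩
  obtain ⟨r, hr⟩ := exists_scalar (i.hom ≫ biprod.fst ≫ biprod.inl ≫ i.inv)
  obtain ⟨s, hs⟩ := exists_scalar (i.hom ≫ biprod.snd ≫ biprod.inr ≫ i.inv)
  have hrs : r * s = 0 := by
    have h0 : (i.hom ≫ biprod.snd ≫ biprod.inr ≫ i.inv) ≫
        (i.hom ≫ biprod.fst ≫ biprod.inl ≫ i.inv) = 0 := by simp
    have h1 : appComp ((i.hom ≫ biprod.snd ≫ biprod.inr ≫ i.inv) ≫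
        (i.hom ≫ biprod.fst ≫ biprod.inl ≫ i.inv)) _ (mono k σ (M.interiorElem σ)) =
        r • s • mono k σ (M.interiorElem σ) := by
      rw [← hs, ← hr]
      rfl
    rw [h0, smul_smul] at h1
    exact (smul_eq_zero.1 h1.symm).resolve_right (mono_ne_zero (by simp))
  rcases mul_eq_zero.1 hrs with rfl | rfl
  · left
    have h0 : i.hom ≫ biprod.fst ≫ biprod.inl ≫ i.inv = 0 :=
      quotPrime_hom_ext fun m => (hr m).trans (zero_smul _ _)
    rw [IsZero.iff_id_eq_zero]
    have : 𝟙 Y = (biprod.inl ≫ i.inv) ≫ (i.hom ≫ biprod.fst ≫ biprod.inl ≫ i.inv) ≫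
        i.hom ≫ biprod.fst := by simp
    rw [this, h0, zero_comp, comp_zero]
  · right
    have h0 : i.hom ≫ biprod.snd ≫ biprod.inr ≫ i.inv = 0 :=
      quotPrime_hom_ext fun m => (hs m).trans (zero_smul _ _)
    rw [IsZero.iff_id_eq_zero]
    have : 𝟙 Z = (biprod.inr ≫ i.inv) ≫ (i.hom ≫ biprod.snd ≫ biprod.inr ≫ i.inv) ≫
        i.hom ≫ biprod.snd := by simp
    rw [this, h0, zero_comp, comp_zero]

end QuotPrime

/-! ### Enough injectives and the classification -/

section Injectives

/-- The index set of the summands in the embedding of `N` into an injective object. -/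
abbrev HullIndex (N : SquarefreeModuleCat k M) : Type v :=
  (σ : K.Cell) × Fin (Module.finrank k (comp N (M.interiorElem σ)))

/-- The embedding of `N` into a direct sum of modules `R/𝔭_σ`. -/
noncomputable def toHull (N : SquarefreeModuleCat k M) :
    N ⟶ ⨁ fun i : HullIndex N => quotPrime k M i.1 :=
  biproduct.lift fun i =>
    toQuotPrime ((Module.finBasis k (comp N (M.interiorElem i.1))).coord i.2)

/-- At each stalk the components of `toHull N` contain all coordinates with respect to a basis, so a
morphism killed by `toHull N` has zero stalks. -/
instance (N : SquarefreeModuleCat k M) : Mono (toHull N) := by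
  refine Preadditive.mono_of_cancel_zero _ fun {Z} g hg => hom_ext_interiorElem fun σ m hm => ?_
  suffices e : appComp g _ ⟨m, hm⟩ = 0 from congrArg Subtype.val e
  refine (Module.finBasis k (comp N (M.interiorElem σ))).ext_elem fun j => ?_
  have h1 : g ≫ toQuotPrime ((Module.finBasis k (comp N (M.interiorElem σ))).coord j) = 0 := by
    have h2 := congrArg (fun f => f ≫ biproduct.π (fun i : HullIndex N => quotPrime k M i.1) ⟨σ, j⟩)
      hg
    simpa [toHull] using h2
  have h3 : appComp (toQuotPrime ((Module.finBasis k (comp N (M.interiorElem σ))).coord j)) _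
      (appComp g _ ⟨m, hm⟩) = 0 :=
    Subtype.ext (congrArg (fun f => app f m) h1)
  rw [appComp_toQuotPrime_self] at h3
  rw [map_zero, Finsupp.zero_apply, ← Module.Basis.coord_apply]
  exact (smul_eq_zero.1 h3).resolve_right (mono_ne_zero (by simp))

instance : EnoughInjectives (SquarefreeModuleCat k M) where
  presentation N := ⟨{ J := ⨁ fun i : HullIndex N => quotPrime k M i.1, f := toHull N }⟩

theorem exists_maximal_component {N : SquarefreeModuleCat k M} (hN : ¬ IsZero N) :
    ∃ σ : K.Cell, (∃ m : comp N (M.interiorElem σ), m ≠ 0) ∧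
      ∀ τ, σ < τ → ∀ m : comp N (M.interiorElem τ), m = 0 := by
  have hne : {σ : K.Cell | ∃ m : comp N (M.interiorElem σ), m ≠ 0}.Nonempty := by
    by_contra h
    rw [Set.not_nonempty_iff_eq_empty, Set.eq_empty_iff_forall_notMem] at h
    refine hN ((IsZero.iff_id_eq_zero _).2 (hom_ext_interiorElem fun σ m hm => ?_))
    have h' := h σ
    simp only [Set.mem_ofPred_eq, not_exists, not_not] at h'
    exact congrArg Subtype.val (h' ⟨m, hm⟩)
  obtain ⟨σ, hσ, hmax⟩ := (wellFounded_gt (α := K.Cell)).has_min _ hne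
  refine ⟨σ, hσ, fun τ hτ m => ?_⟩
  by_contra hm
  exact hmax τ ⟨m, hm⟩ hτ

/-- A nonzero injective object has a direct summand of the form `R/𝔭_σ`. -/
theorem exists_retract_quotPrime {I : SquarefreeModuleCat k M} [Injective I] (hI : ¬ IsZero I) :
    ∃ (σ : K.Cell) (g : quotPrime k M σ ⟶ I) (f : I ⟶ quotPrime k M σ), g ≫ f = 𝟙 _ := by
  obtain ⟨σ, ⟨v, hv⟩, hmax⟩ := exists_maximal_component hI
  -- Injectivity of `I` splits the embedding, so the identity of `I` is a sum of endomorphisms each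
  -- factoring through some `R/𝔭_τ`.
  let r := Injective.factorThru (𝟙 I) (toHull I)
  have hr : toHull I ≫ r = 𝟙 I := Injective.comp_factorThru _ _
  let Q := fun i : HullIndex I => quotPrime k M i.1
  have hsum : ∑ i, (toHull I ≫ biproduct.π Q i) ≫ (biproduct.ι Q i ≫ r) = 𝟙 I := by
    have h : toHull I ≫ (∑ i, biproduct.π Q i ≫ biproduct.ι Q i) ≫ r = 𝟙 I := by
      have ht : ∑ i, biproduct.π Q i ≫ biproduct.ι Q i = 𝟙 (⨁ Q) := by
        refine biproduct.hom_ext _ _ fun j => ?_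
        rw [Preadditive.sum_comp, Finset.sum_eq_single j]
        · simp
        · intro i _ hij
          rw [Category.assoc, biproduct.ι_π_ne Q hij, comp_zero]
        · intro hj
          exact absurd (Finset.mem_univ _) hj
      rw [ht]
      exact (congrArg (toHull I ≫ ·) (Category.id_comp r)).trans hr
    rw [Preadditive.sum_comp, Preadditive.comp_sum] at h
    rw [← h]
    exact Finset.sum_congr rfl fun i _ => by simp only [Category.assoc]
  -- Their sum fixes `v ≠ 0`, so one of them does not kill it.
  have hex : ∃ i : HullIndex I, app (biproduct.ι Q i ≫ r) (app (toHull I ≫ biproduct.π Q i) v) ≠ 0 := by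
    by_contra! h
    refine hv (Subtype.ext ?_)
    have h1 := congrArg (fun f => app f v.1) hsum
    simp only [app_sum, app_id] at h1
    rw [← h1]
    exact Finset.sum_eq_zero fun i _ => h i
  obtain ⟨⟨τ, j⟩, hi⟩ := hex
  set f := toHull I ≫ biproduct.π Q ⟨τ, j⟩
  set g := biproduct.ι Q ⟨τ, j⟩ ≫ r
  have hfv : appComp f _ v ≠ 0 := by
    intro h
    apply hi
    have : app f v.1 = 0 := congrArg Subtype.val h
    rw [this, map_zero]
  have hστ : σ ≤ τ := by
    by_contra h
    exact hfv (eq_zero_of_not_supp_le (by simpa using h) _)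
  -- If `σ < τ`, then maximality makes the stalk of `I` at `τ` zero, and `f`, being determined by
  -- that stalk, vanishes.
  obtain rfl : σ = τ := by
    by_contra hne
    have hlt := lt_of_le_of_ne hστ hne
    have h0 : f = 0 := quotPrime_hom_ext fun m => by rw [hmax τ hlt m, map_zero, map_zero]
    apply hfv
    rw [h0]
    rfl
  obtain ⟨s, hs⟩ := exists_eq_smul_mono (appComp f _ v)
  have hw : appComp g _ (mono k σ (M.interiorElem σ)) ≠ 0 := by
    intro h
    apply hi
    have h1 : appComp g _ (appComp f _ v) = 0 := by rw [hs, map_smul, h, smul_zero]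
    exact congrArg Subtype.val h1
  -- A functional that is nonzero on the image of the generator, rescaled to take the value `1`
  -- there, defines a retraction of `g`.
  obtain ⟨φ, hφ⟩ : ∃ φ : Module.Dual k (comp I (M.interiorElem σ)),
      φ (appComp g _ (mono k σ (M.interiorElem σ))) ≠ 0 := by
    by_contra! h
    exact hw ((Module.forall_dual_apply_eq_zero_iff k _).1 h)
  refine ⟨σ, g, toQuotPrime ((φ (appComp g _ (mono k σ (M.interiorElem σ))))⁻¹ • φ),
    quotPrime_hom_ext fun m => ?_⟩
  obtain ⟨s, rfl⟩ := exists_eq_smul_mono m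
  have h1 : ∀ ψ : comp I (M.interiorElem σ) →ₗ[k] k,
    appComp (g ≫ toQuotPrime ψ) _ (s • mono k σ (M.interiorElem σ)) =
      appComp (toQuotPrime ψ) _ (appComp g _ (s • mono k σ (M.interiorElem σ))) := fun _ => rfl
  rw [h1, appComp_toQuotPrime_self, LinearMap.smul_apply, map_smul, map_smul, smul_comm,
    smul_eq_mul, smul_eq_mul, inv_mul_cancel₀ hφ, mul_one]
  rfl

/-- A split monomorphism exhibits `I` as the sum of `R/𝔭_σ` and the cokernel. Indecomposability
kills the cokernel, and `g` becomes an isomorphism. -/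
theorem exists_iso_quotPrime {I : SquarefreeModuleCat k M} (h : Injective I)
    (h' : Indecomposable I) : ∃ σ : K.Cell, Nonempty (I ≅ quotPrime k M σ) := by
  obtain ⟨σ, g, f, hgf⟩ := exists_retract_quotPrime h'.1
  have : IsSplitMono g := ⟨⟨⟨f, hgf⟩⟩⟩
  let i := biprod.uniqueUpToIso _ _
    (isBilimitBinaryBiconeOfIsSplitMonoOfCokernel (f := g) (cokernelIsCokernel g))
  refine ⟨σ, ?_⟩
  rcases h'.2 _ _ i with hz | hz
  · exact absurd hz (not_isZero_quotPrime σ)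
  · have : Epi g := Preadditive.epi_of_cokernel_zero (hz.eq_of_tgt _ _)
    have : IsIso g := isIso_of_epi_of_isSplitMono g
    exact ⟨(asIso g).symm⟩

theorem injective_and_indecomposable_iff (I : SquarefreeModuleCat k M) :
    Injective I ∧ Indecomposable I ↔ ∃ σ : K.Cell, Nonempty (I ≅ quotPrime k M σ) := by
  constructor
  · rintro ⟨h, h'⟩
    exact exists_iso_quotPrime h h'
  · rintro ⟨σ, ⟨i⟩⟩
    refine ⟨Injective.of_iso i.symm inferInstance, ?_, fun Y Z j => ?_⟩
    · exact fun h => not_isZero_quotPrime σ (h.of_iso i.symm)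
    · exact (indecomposable_quotPrime σ).2 Y Z (i.symm ≪≫ j)

end Injectives

end SquarefreeModuleCat

/-- The abelian structure is tied to the pointwise addition by an equation. Binary biproducts are
asserted first because `Indecomposable` is formulated with them. -/
theorem mainTheorem10 {X : Type v} [TopologicalSpace X] (K : RegularCellComplex X)
    (C : ConicalComplex K) (M : MonoidalComplex C) (k : Type u) [Field k]
    (hM : M.IsConewiseNormal k) :
    Nonempty (SquarefreeModuleCat k M ≌ FGModuleCat.{max u v} (CellIncidenceAlgebra K k)) ∧
    (∃ A : Abelian (SquarefreeModuleCat k M),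
      A.toPreadditive = SquarefreeModuleCat.preadditive k M) ∧
    EnoughInjectives (SquarefreeModuleCat k M) ∧
    ∃ _ : Limits.HasBinaryBiproducts (SquarefreeModuleCat k M),
      ∀ I : SquarefreeModuleCat k M,
        Injective I ∧ Indecomposable I ↔ ∃ σ : K.Cell, Nonempty (I ≅ quotPrime k M σ) :=
  ⟨⟨(CellIncidenceAlgebra.toSquarefree M k).asEquivalence.symm⟩,
    SquarefreeModuleCat.exists_abelian, inferInstance, inferInstance,
    SquarefreeModuleCat.injective_and_indecomposable_iff⟩
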